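/- **Setting.** Let $X=(x_1,\dots,x_N)$ be a finite list of vectors spanning $U=\mathbb R^r$. Sublists of $X$ are identified with subsets of $\{1,\dots,N\}$ (repeated vectors are kept apart) and inherit the order of $X$; write $x_i<x_j$ if $i<j$. Let $\mathbb B(X)$ be the set of sublists of $X$ that are bases of $U$. For a basis $B=(b_1,\dots,b_r)\in\mathbb B(X)$ (in the order of $X$) let $S_i^B=\operatorname{span}(b_1,\dots,b_i)$, let $\det(B)$ be the determinant of the matrix with columns $b_1,\dots,b_r$, and let $E(B)$ be the set of all $x\in X\setminus B$ with $x\in\operatorname{span}\{b\in B: b\le x\}$. A set $\mathbb B'\subseteq\mathbb B(X)$ has the *forward exchange property* if for all $B\in\mathbb B'$, all $i\in\{1,\dots,r\}$ and all $x\in X$ that lie in $S_i^B$ but not in $S_{i-1}^B$ and are not in $E(B)$, one has $(B\setminus b_i)\cup x\in\mathbb B'$. For $p\in\mathbb R[s_1,\dots,s_r]$ and $f\in\mathbb R[t_1,\dots,t_r]$ let $\langle p,f\rangle=\bigl(p(\tfrac{\partial}{\partial t_1},\dots,\tfrac{\partial}{\partial t_r})f\bigr)(0)$. For $x=(\lambda_1,\dots,\lambda_r)\in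 U$ let $p_x=\sum_j\lambda_js_j$, and for a sublist $Y\subseteq X$ let $p_Y=\prod_{x\in Y}p_x$. A *$\mathbb B'$-cocircuit* is a sublist $C\subseteq X$ that is inclusion-minimal among those that intersect every $B\in\mathbb B'$. Let $\mathcal J(X,\mathbb B')\subseteq\mathbb R[s_1,\dots,s_r]$ be the ideal generated by all $p_C$, $C$ a $\mathbb B'$-cocircuit, and $$\mathcal D(X,\mathbb B')=\{f\in\mathbb R[t_1,\dots,t_r]:\langle q,f\rangle=0\text{ for all }q\in\mathcal J(X,\mathbb B')\},$$ $$Q_B=p_{X\setminus(B\cup E(B))},\qquad \mathcal P(X,\mathbb B')=\operatorname{span}\{Q_B:B\in\mathbb B'\}.$$ For a finite list $Y=(y_1,\dots,y_m)$ of vectors that all lie in one open half-space, let $T_Y$ be the distribution $T_Y(\varphi)=\int_0^\infty\!\cdots\!\int_0^\infty\varphi\bigl(\sum_i\lambda_iy_i\bigr)\,d\lambda_1\cdots d\lambda_m$ on $U$ (so $T_\emptyset=\delta_0$). Let $B\in\mathbb B(X)$ and $Z=X\setminus E(B)$. For $i=1,\dots,r$, let $P_i$ (respectively $N_i$) consist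 of the elements of $Z\cap(S_i^B\setminus S_{i-1}^B)$ whose $b_i$-coordinate with respect to $(b_1,\dots,b_i)$ is positive (respectively negative). Put $$R_i^B=(-1)^{|N_i|}\,T_{P_i}*T_{-N_i}-(-1)^{|P_i|}\,T_{-P_i}*T_{N_i},\qquad R^B_{X\setminus E(B)}=R_1^B*\cdots*R_r^B$$ (convolution of distributions). **Theorem.** Suppose that $\mathbb B'\subseteq\mathbb B(X)$ has the forward exchange property. Then: 1. $\mathcal D(X,\mathbb B')$ and $\mathcal P(X,\mathbb B')$ are dual via the pairing, i.e. the linear map $\mathcal D(X,\mathbb B')\to\mathcal P(X,\mathbb B')^*$, $f\mapsto\langle\,\cdot\,,f\rangle$, is an isomorphism. 2. For every $B\in\mathbb B'$ the distribution $R^B_{X\setminus E(B)}$ is (integration against) a polynomial in $\mathbb R[t_1,\dots,t_r]$, denoted by the same symbol; the family $\bigl(|\det(B)|\,R^B_{X\setminus E(B)}\bigr)_{B\in\mathbb B'}$ is a basis of $\mathcal D(X,\mathbb B')$, the family $(Q_B)_{B\in\mathbb B'}$ is a basis of $\mathcal P(X,\mathbb B')$, and these bases are dual: $$\bigl\langle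 Q_B,\ |\det(D)|\,R^D_{X\setminus E(D)}\bigr\rangle=\delta_{B,D}\qquad\text{for all }B,D\in\mathbb B'.$$ -/

import Mathlib

/-!
Conventions. The ambient space is `U = ℝ^r`, written `Fin r → ℝ` and equipped with the standard
basis and Lebesgue measure `volume`. A list `X = (x₁, …, x_N)` of vectors is a map
`X : Fin N → Fin r → ℝ`; sublists of `X` are finite sets of indices (so that repeated vectors are
kept apart) and carry the order of the indices. Both `Sym(U) ≅ ℝ[s₁, …, s_r]` and
`Sym(V) ≅ ℝ[t₁, …, t_r]`, where `V` is the dual space of `U`, are `MvPolynomial (Fin r) ℝ`.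
An element of `Sym(V)` is a polynomial function on `U`.
-/

noncomputable section

namespace ZonotopalSpaces

open MeasureTheory MvPolynomial
open scoped Classical

variable {r N : ℕ}

/-! ### Bases, flags, external activity, forward exchange -/

/-- The sublist `B` of `X` is a basis of `ℝ^r`, that is `B ∈ 𝔹(X)`. -/
def IsBasis (X : Fin N → Fin r → ℝ) (B : Finset (Fin N)) : Prop :=
  LinearIndependent ℝ (fun i : B => X i) ∧ Submodule.span ℝ (X '' (B : Set (Fin N))) = ⊤

/-- `flagLE X B b` is the span of all elements of `B` up to and including `b`.
If `B = (b₁, …, b_r)` and `b = bᵢ`, this is the subspace `Sᵢ = span(b₁, …, bᵢ)`. -/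
def flagLE (X : Fin N → Fin r → ℝ) (B : Finset (Fin N)) (b : Fin N) :
    Submodule ℝ (Fin r → ℝ) :=
  Submodule.span ℝ (X '' {c | c ∈ B ∧ c ≤ b})

/-- `flagLT X B b` is the span of all elements of `B` strictly before `b`.
If `B = (b₁, …, b_r)` and `b = bᵢ`, this is the subspace `Sᵢ₋₁ = span(b₁, …, bᵢ₋₁)`. -/
def flagLT (X : Fin N → Fin r → ℝ) (B : Finset (Fin N)) (b : Fin N) :
    Submodule ℝ (Fin r → ℝ) :=
  Submodule.span ℝ (X '' {c | c ∈ B ∧ c < b})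

/-- The set `E(B)` of externally active elements: those `x ∈ X ∖ B` that lie in the closure
(that is, in the span) of `{b ∈ B : b ≤ x}`. -/
def extActive (X : Fin N → Fin r → ℝ) (B : Finset (Fin N)) : Finset (Fin N) :=
  Finset.univ.filter fun x => x ∉ B ∧ X x ∈ flagLE X B x

/-- The forward exchange property of a set `𝔹'` of bases: for all `B = (b₁, …, b_r) ∈ 𝔹'`, all
`i`, and all `x ∈ X` in `Sᵢ` but not in `Sᵢ₋₁ ∪ E(B)`, the set `(B ∖ bᵢ) ∪ x` is in `𝔹'`. -/
def ForwardExchange (X : Fin N → Fin r → ℝ) (𝔹' : Set (Finset (Fin N))) : Prop :=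
  ∀ B ∈ 𝔹', ∀ b ∈ B, ∀ x : Fin N,
    X x ∈ flagLE X B b → X x ∉ flagLT X B b → x ∉ extActive X B → insert x (B.erase b) ∈ 𝔹'

/-- The determinant of the matrix whose columns are the elements of `B` in increasing order
(and `0` if `B` does not have `r` elements). -/
def basisDet (X : Fin N → Fin r → ℝ) (B : Finset (Fin N)) : ℝ :=
  if h : B.card = r then
    (Matrix.of fun i j : Fin r => X (B.orderEmbOfFin h j) i).det
  else 0

/-! ### The pairing -/

/-- `diffOp r p` is the constant coefficient differential operator `p(∂/∂t₁, …, ∂/∂t_r)`. It is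
linear in `p` and the monomial `s₁^{m₁} ⋯ s_r^{m_r}` acts by `(∂/∂t₁)^{m₁} ⋯ (∂/∂t_r)^{m_r}`. -/
def diffOp (r : ℕ) :
    MvPolynomial (Fin r) ℝ →ₗ[ℝ] MvPolynomial (Fin r) ℝ →ₗ[ℝ] MvPolynomial (Fin r) ℝ :=
  (basisMonomials (Fin r) ℝ).constr ℝ fun m =>
    ((List.finRange r).map fun i =>
      ((pderiv i).toLinearMap : Module.End ℝ (MvPolynomial (Fin r) ℝ)) ^ (m i)).prod

/-- The pairing `⟨p, f⟩ = (p(∂/∂t₁, …, ∂/∂t_r) f)(0)`. -/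
def pairing (r : ℕ) : MvPolynomial (Fin r) ℝ →ₗ[ℝ] MvPolynomial (Fin r) ℝ →ₗ[ℝ] ℝ :=
  (diffOp r).compr₂ (aeval (0 : Fin r → ℝ)).toLinearMap

/-! ### The generalised `D`-space and the generalised `P`-space -/

/-- `p_Y = ∏_{x ∈ Y} p_x`, where `p_x = ∑ⱼ λⱼ sⱼ` for `x = (λ₁, …, λ_r)`. -/
def prodPoly (X : Fin N → Fin r → ℝ) (Y : Finset (Fin N)) : MvPolynomial (Fin r) ℝ :=
  ∏ x ∈ Y, ∑ j, C (X x j) * MvPolynomial.X j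

/-- `C` is a `𝔹'`-cocircuit: it is inclusion-minimal among the sets that intersect every
element of `𝔹'`. -/
def IsCocircuit (𝔹' : Set (Finset (Fin N))) (C : Finset (Fin N)) : Prop :=
  Minimal (fun D : Finset (Fin N) => ∀ B ∈ 𝔹', (D ∩ B).Nonempty) C

/-- The ideal `J(X, 𝔹')` generated by the products `p_C` over all `𝔹'`-cocircuits `C`. -/
def cocircuitIdeal (X : Fin N → Fin r → ℝ) (𝔹' : Set (Finset (Fin N))) :
    Ideal (MvPolynomial (Fin r) ℝ) :=
  Ideal.span (prodPoly X '' {C | IsCocircuit 𝔹' C})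

/-- The kernel (Macaulay inverse system) `{f : ⟨q, f⟩ = 0 for all q ∈ I}` of an ideal. -/
def idealKer (I : Ideal (MvPolynomial (Fin r) ℝ)) : Submodule ℝ (MvPolynomial (Fin r) ℝ) where
  carrier := {f | ∀ q ∈ I, pairing r q f = 0}
  zero_mem' := fun q _ => map_zero (pairing r q)
  add_mem' := fun {f g} hf hg q hq => by
    rw [map_add, hf q hq, hg q hq, add_zero]
  smul_mem' := fun c f hf q hq => by
    rw [map_smul, hf q hq, smul_zero]

/-- The generalised space `D(X, 𝔹') = ker J(X, 𝔹')`. -/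
def spaceD (X : Fin N → Fin r → ℝ) (𝔹' : Set (Finset (Fin N))) :
    Submodule ℝ (MvPolynomial (Fin r) ℝ) :=
  idealKer (cocircuitIdeal X 𝔹')

/-- `Q_B = p_{X ∖ (B ∪ E(B))}`. -/
def polyQ (X : Fin N → Fin r → ℝ) (B : Finset (Fin N)) : MvPolynomial (Fin r) ℝ :=
  prodPoly X (Finset.univ \ (B ∪ extActive X B))

/-- The generalised space `P(X, 𝔹') = span {Q_B : B ∈ 𝔹'}`. -/
def spaceP (X : Fin N → Fin r → ℝ) (𝔹' : Set (Finset (Fin N))) :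
    Submodule ℝ (MvPolynomial (Fin r) ℝ) :=
  Submodule.span ℝ (polyQ X '' 𝔹')

/-- The linear map `D(X, 𝔹') → P(X, 𝔹')^*`, `f ↦ ⟨·, f⟩`, induced by the pairing. -/
def dualityMap (X : Fin N → Fin r → ℝ) (𝔹' : Set (Finset (Fin N))) :
    spaceD X 𝔹' →ₗ[ℝ] Module.Dual ℝ (spaceP X 𝔹') :=
  (spaceP X 𝔹').subtype.dualMap ∘ₗ (pairing r).flip ∘ₗ (spaceD X 𝔹').subtype

/-! ### Multivariate splines and the distributions `R^B_Z`

All distributions below are of order zero (integration against a difference of two locally finite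
measures). They are written as functionals on functions `ℝ^r → ℝ`, so that they can be evaluated
on test functions and also on the functions that occur in the definition of a convolution. -/

/-- A functional on functions on `ℝ^r`; it is only evaluated where its integrals converge. -/
abbrev Functional (r : ℕ) : Type := ((Fin r → ℝ) → ℝ) → ℝ

/-- The multivariate spline `T_Y` of a finite list `Y = (y_i)_{i ∈ ι}` of vectors:
`T_Y(φ) = ∫_{λ ≥ 0} φ(∑ᵢ λᵢ yᵢ) dλ`. For the empty list this is the delta distribution at `0`. -/
def spline {ι : Type} [Fintype ι] (y : ι → Fin r → ℝ) : Functional r :=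
  fun φ => ∫ l in {l : ι → ℝ | ∀ i, 0 ≤ l i}, φ (∑ i, l i • y i)

/-- The delta distribution at the origin, the unit of convolution. -/
def delta (r : ℕ) : Functional r := fun φ => φ 0

/-- Convolution `(S * T)(φ) = S_ξ (T_η (φ(ξ + η)))`. (The usual cutoff function of `ξ`, equal to
one near `supp S ∩ (supp φ - supp T)`, is not needed: it does not change the integrand on the
support of `S`, and here `S` is given by integration over its support.) -/
def convolve (S T : Functional r) : Functional r :=
  fun φ => S fun ξ => T fun η => φ (ξ + η)

/-- A vector `u ∈ Sᵢ ∖ Sᵢ₋₁` is positive if `(b₁, …, bᵢ₋₁, u)` has the same orientation as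
`(b₁, …, bᵢ)`. The determinant of the base change is the `bᵢ`-coordinate of `u`, so this says that
`u ∈ c bᵢ + Sᵢ₋₁` for some `c > 0`. Here `b = bᵢ`. -/
def IsPositive (X : Fin N → Fin r → ℝ) (B : Finset (Fin N)) (b : Fin N) (u : Fin r → ℝ) : Prop :=
  ∃ c : ℝ, 0 < c ∧ u - c • X b ∈ flagLT X B b

/-- `Pᵢ`: the positive elements of `Z ∩ (Sᵢ ∖ Sᵢ₋₁)`, for `b = bᵢ`. -/
def posPart (X : Fin N → Fin r → ℝ) (Z B : Finset (Fin N)) (b : Fin N) : Finset (Fin N) :=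
  Z.filter fun z => X z ∈ flagLE X B b ∧ X z ∉ flagLT X B b ∧ IsPositive X B b (X z)

/-- `Nᵢ`: the negative (that is, not positive) elements of `Z ∩ (Sᵢ ∖ Sᵢ₋₁)`, for `b = bᵢ`. -/
def negPart (X : Fin N → Fin r → ℝ) (Z B : Finset (Fin N)) (b : Fin N) : Finset (Fin N) :=
  Z.filter fun z => X z ∈ flagLE X B b ∧ X z ∉ flagLT X B b ∧ ¬ IsPositive X B b (X z)

/-- The spline `T_Y` of a sublist `Y` of `X`. -/
def splinePlus (X : Fin N → Fin r → ℝ) (Y : Finset (Fin N)) : Functional r :=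
  spline fun i : Y => X i

/-- The spline `T_{-Y}` of the negatives of a sublist `Y` of `X`. -/
def splineMinus (X : Fin N → Fin r → ℝ) (Y : Finset (Fin N)) : Functional r :=
  spline fun i : Y => -X i

/-- The factor `Rᵢ = Tᵢ⁺ - Tᵢ⁻`, for `b = bᵢ`, where
`Tᵢ⁺ = (-1)^{|Nᵢ|} T_{Pᵢ} * T_{-Nᵢ}` and `Tᵢ⁻ = (-1)^{|Pᵢ|} T_{-Pᵢ} * T_{Nᵢ}`. -/
def factorR (X : Fin N → Fin r → ℝ) (Z B : Finset (Fin N)) (b : Fin N) : Functional r :=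
  (-1 : ℝ) ^ (negPart X Z B b).card •
      convolve (splinePlus X (posPart X Z B b)) (splineMinus X (negPart X Z B b)) -
    (-1 : ℝ) ^ (posPart X Z B b).card •
      convolve (splineMinus X (posPart X Z B b)) (splinePlus X (negPart X Z B b))

/-- The distribution `R^B_Z = R₁ * R₂ * ⋯ * R_r`, with the factors in the order of
`B = (b₁, …, b_r)`. -/
def distR (X : Fin N → Fin r → ℝ) (Z B : Finset (Fin N)) : Functional r :=
  ((B.sort (· ≤ ·)).map (factorR X Z B)).foldr convolve (delta r)

/-- The distribution `T` is (integration against) the polynomial `p`: for all test functions `φ`,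
that is, all compactly supported smooth functions, `T(φ) = ∫ p(u) φ(u) du`. -/
def IsGivenBy (T : Functional r) (p : MvPolynomial (Fin r) ℝ) : Prop :=
  ∀ φ : TestFunction (⊤ : TopologicalSpace.Opens (Fin r → ℝ)) ℝ (⊤ : ℕ∞),
    T φ = ∫ u, eval u p * φ u

end ZonotopalSpaces

end

/-! For a basis `B = (b₁, …, b_r)`, sort the elements outside `E(B)` into blocks: block `i` consists
of those in `Sᵢ ∖ Sᵢ₋₁`. Starting from the constant `1`, integrate for `i = 1, …, r` along every
vector of block `i` except `bᵢ`, each time choosing the antiderivative that vanishes where the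
`bᵢ`-coordinate is zero. The result `polyF X B` is homogeneous of degree `|X ∖ (B ∪ E(B))|`, and the
theorem splits into four facts about it.

Duality (`pairing_polyQ_polyF`): `Q_B(∂)` undoes all integrations that define `polyF X B`, so the
diagonal pairing is `1`. A product of derivatives that contains a whole block of `D` kills `polyF X
D`. If `Q_B` contains no block of `D`, then every block of `D` meets `B ∪ E(B)`; a triangular
argument gives `D ∪ E(D) ⊆ B ∪ E(B)`, strictly for `B ≠ D`, and the pairing vanishes by degree.

Membership (`polyF_mem_spaceD`): by forward exchange, one element chosen from each block of `D`
forms a member of `𝔹'`. A cocircuit meets all these transversals, so it contains a whole block and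
kills `polyF X D`.

Injectivity (`eq_zero_of_contraction`): an element of the `D`-space orthogonal to all `Q_B` is zero.
The elements of `X` are treated in order by deletion and contraction; forward exchange makes the
hypotheses pass to the contraction.

Analysis (`isGivenBy_distR`): convolution with the ray spanned by `y` acts on a polynomial density
on a half-space `t ≥ 0` with `t y > 0` as antidifferentiation along `y`. The two terms of the factor
`Rᵢ` give the same polynomial on the two halves of `Sᵢ`, so `Rᵢ` turns polynomial densities on
`Sᵢ₋₁` into polynomial densities on `Sᵢ`. Starting from the point mass at `0`, the density becomes
`polyF X B`, with respect to `|det B|⁻¹` times Lebesgue measure.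

The rest is linear algebra with two finite dual families. -/

noncomputable section

namespace ZonotopalSpaces

open MeasureTheory MvPolynomial
open scoped Classical

variable {r N : ℕ}

/-! ### Directional derivatives -/

/-- The directional derivative of polynomials along `x`. -/
def dirD (x : Fin r → ℝ) :
    Derivation ℝ (MvPolynomial (Fin r) ℝ) (MvPolynomial (Fin r) ℝ) :=
  mkDerivation ℝ fun j => C (x j)

/-- The linear form with coefficient vector `x`. -/
def linPoly (x : Fin r → ℝ) : MvPolynomial (Fin r) ℝ := ∑ j, C (x j) * X j

@[simp] lemma dirD_X (x : Fin r → ℝ) (j : Fin r) : dirD x (X j) = C (x j) := by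
  simp [dirD]

lemma dirD_add (x y : Fin r → ℝ) (f : MvPolynomial (Fin r) ℝ) :
    dirD (x + y) f = dirD x f + dirD y f := by
  rw [← Derivation.add_apply]; congr 1
  exact derivation_ext fun j => by simp

lemma dirD_smul (c : ℝ) (x : Fin r → ℝ) (f : MvPolynomial (Fin r) ℝ) :
    dirD (c • x) f = c • dirD x f := by
  rw [← Derivation.smul_apply]; congr 1
  exact derivation_ext fun j => by simp [smul_eq_C_mul]

lemma dirD_neg (x : Fin r → ℝ) (f : MvPolynomial (Fin r) ℝ) : dirD (-x) f = -dirD x f := by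
  simpa using dirD_smul (-1) x f

lemma dirD_zero (f : MvPolynomial (Fin r) ℝ) : dirD (0 : Fin r → ℝ) f = 0 := by
  simpa using dirD_smul 0 0 f

lemma dirD_eq_sum (x : Fin r → ℝ) (f : MvPolynomial (Fin r) ℝ) :
    dirD x f = ∑ j, x j • pderiv j f := by
  have h (g : MvPolynomial (Fin r) ℝ) :
      (∑ j, x j • (pderiv j : Derivation ℝ (MvPolynomial (Fin r) ℝ) _)) g =
        ∑ j, x j • pderiv j g := by
    have := congrFun (map_sum (Derivation.coeFnAddMonoidHom (R := ℝ)
      (A := MvPolynomial (Fin r) ℝ) (M := MvPolynomial (Fin r) ℝ))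
      (fun j => x j • pderiv j) Finset.univ) g
    rw [Finset.sum_apply] at this
    exact this
  have : dirD x = ∑ j, x j • (pderiv j : Derivation ℝ (MvPolynomial (Fin r) ℝ) _) := by
    refine derivation_ext fun i => ?_
    rw [h, Finset.sum_eq_single i]
    · simp [smul_eq_C_mul]
    · intro j _ hj; simp [pderiv_X_of_ne hj.symm]
    · simp
  rw [this, h]

/-- The commutator is again a derivation, and it kills the variables because `dirD` sends them to
constants. -/
lemma dirD_comm (x y : Fin r → ℝ) (f : MvPolynomial (Fin r) ℝ) :
    dirD x (dirD y f) = dirD y (dirD x f) := by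
  have : ⁅dirD x, dirD y⁆ = 0 := derivation_ext fun j => by
    simp [Derivation.commutator_apply]
  have h := congrArg (fun d => d f) this
  simpa [Derivation.commutator_apply, sub_eq_zero] using h

lemma dirD_eq_zero_of_mem_span {s : Set (Fin r → ℝ)} {f : MvPolynomial (Fin r) ℝ}
    (h : ∀ x ∈ s, dirD x f = 0) {x : Fin r → ℝ} (hx : x ∈ Submodule.span ℝ s) :
    dirD x f = 0 := by
  induction hx using Submodule.span_induction with
  | mem x hx => exact h x hx
  | zero => exact dirD_zero f
  | add x y _ _ hx hy => rw [dirD_add, hx, hy, add_zero]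
  | smul c x _ hx => rw [dirD_smul, hx, smul_zero]

lemma IsHomogeneous.dirD {f : MvPolynomial (Fin r) ℝ} {n : ℕ} (hf : f.IsHomogeneous n)
    (x : Fin r → ℝ) : (dirD x f).IsHomogeneous (n - 1) := by
  rw [dirD_eq_sum]
  refine IsHomogeneous.sum _ _ _ fun j _ => ?_
  rw [smul_eq_C_mul]
  simpa using (isHomogeneous_C (Fin r) (x j)).mul hf.pderiv

lemma hasDerivAt_eval (u x : Fin r → ℝ) (f : MvPolynomial (Fin r) ℝ) (s : ℝ) :
    HasDerivAt (fun s : ℝ => eval (u + s • x) f) (eval (u + s • x) (dirD x f)) s := by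
  induction f using MvPolynomial.induction_on with
  | C a => simpa using hasDerivAt_const s a
  | add p q hp hq => simp only [map_add]; exact hp.add hq
  | mul_X p j hp =>
    have h1 : HasDerivAt (fun s : ℝ => eval (u + s • x) (X j : MvPolynomial (Fin r) ℝ))
        (x j) s := by
      simpa using ((hasDerivAt_id s).mul_const (x j)).const_add (u j)
    have := hp.mul h1
    simp only [map_mul]
    refine this.congr_deriv ?_
    simp; ring

lemma eval_add_smul_of_dirD_eq_zero {x : Fin r → ℝ} {f : MvPolynomial (Fin r) ℝ}
    (h : dirD x f = 0) (u : Fin r → ℝ) (s : ℝ) : eval (u + s • x) f = eval u f := by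
  have := is_const_of_deriv_eq_zero (f := fun s : ℝ => eval (u + s • x) f)
    (fun s => (hasDerivAt_eval u x f s).differentiableAt)
    (fun s => by rw [(hasDerivAt_eval u x f s).deriv, h, map_zero]) s 0
  simpa using this

lemma eq_C_of_dirD_eq_zero {f : MvPolynomial (Fin r) ℝ} (h : ∀ x, dirD x f = 0) :
    f = C (eval 0 f) := by
  refine MvPolynomial.funext fun u => ?_
  simpa using eval_add_smul_of_dirD_eq_zero (h u) 0 1

/-! ### The pairing is multiplicative and non-degenerate -/

/-- Commutativity lets the additional factor be moved to the right end. This is what makes `diffOp`,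
defined by ordered products on monomials, multiplicative. -/
lemma list_prod_pow_add_single {M ι : Type*} [Monoid M] [DecidableEq ι] (A : ι → M)
    (hA : ∀ i j, Commute (A i) (A j)) (m : ι → ℕ) (i : ι) (l : List ι) (hl : l.Nodup) :
    (l.map fun j => A j ^ (m j + if j = i then 1 else 0)).prod =
      (l.map fun j => A j ^ m j).prod * if i ∈ l then A i else 1 := by
  induction l with
  | nil => simp
  | cons a l ih =>
    rw [List.nodup_cons] at hl
    rw [List.map_cons, List.prod_cons, ih hl.2, List.map_cons, List.prod_cons]
    by_cases h : a = i
    · subst h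
      have hc : Commute (A a) (l.map fun j => A j ^ m j).prod :=
        Commute.list_prod_right _ _ fun x hx => by
          obtain ⟨j, -, rfl⟩ := List.mem_map.1 hx
          exact (hA a j).pow_right _
      simp only [if_true, hl.1, if_false, mul_one, List.mem_cons, true_or]
      rw [pow_succ, mul_assoc, hc.eq, mul_assoc]
    · have : (i = a) = False := by simpa using Ne.symm h
      simp [h, this, mul_assoc]

lemma pderiv_commute (i j : Fin r) :
    Commute ((pderiv i).toLinearMap : Module.End ℝ (MvPolynomial (Fin r) ℝ))
      (pderiv j).toLinearMap := by
  refine LinearMap.ext fun f => ?_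
  have : ⁅(pderiv i : Derivation ℝ (MvPolynomial (Fin r) ℝ) _), pderiv j⁆ = 0 :=
    derivation_ext fun k => by
      rw [Derivation.commutator_apply]; simp [pderiv_X, Pi.single_apply, apply_ite]
  have h := congrArg (fun d => d f) this
  rw [Derivation.commutator_apply] at h
  exact sub_eq_zero.1 h

lemma diffOp_monomial (m : Fin r →₀ ℕ) :
    diffOp r (monomial m 1) = ((List.finRange r).map fun i =>
      ((pderiv i).toLinearMap : Module.End ℝ (MvPolynomial (Fin r) ℝ)) ^ (m i)).prod := by
  have h : monomial m 1 = basisMonomials (Fin r) ℝ m := by rw [coe_basisMonomials]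
  rw [diffOp, h, Module.Basis.constr_basis]

lemma diffOp_mul_X (q f : MvPolynomial (Fin r) ℝ) (i : Fin r) :
    diffOp r (q * X i) f = diffOp r q (pderiv i f) := by
  induction q using MvPolynomial.induction_on' with
  | add p q hp hq => simp [add_mul, hp, hq]
  | monomial m a =>
    have h1 : (monomial m a : MvPolynomial (Fin r) ℝ) = a • monomial m 1 := by
      simp [smul_monomial]
    have h2 : (monomial m 1 * X i : MvPolynomial (Fin r) ℝ)
        = monomial (m + Finsupp.single i 1) 1 := by
      rw [X, monomial_mul, one_mul]
    rw [h1, smul_mul_assoc, h2, map_smul, map_smul, diffOp_monomial, diffOp_monomial,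
      LinearMap.smul_apply, LinearMap.smul_apply]
    congr 1
    have := list_prod_pow_add_single
      (fun j => ((pderiv j).toLinearMap : Module.End ℝ (MvPolynomial (Fin r) ℝ)))
      pderiv_commute m i (List.finRange r) (List.nodup_finRange r)
    simp only [List.mem_finRange, if_true] at this
    have h3 : ∀ j, (m + Finsupp.single i 1 : Fin r →₀ ℕ) j =
        m j + if j = i then 1 else 0 := fun j => by
      simp [Finsupp.single_apply, eq_comm]
    simp only [h3, this]
    rfl

lemma diffOp_one (f : MvPolynomial (Fin r) ℝ) : diffOp r 1 f = f := by
  have h : (1 : MvPolynomial (Fin r) ℝ) = monomial 0 1 := rfl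
  rw [h, diffOp_monomial]
  have : ∀ l : List (Fin r), (l.map fun i =>
      ((pderiv i).toLinearMap : Module.End ℝ (MvPolynomial (Fin r) ℝ)) ^
        ((0 : Fin r →₀ ℕ) i)).prod = 1 := by
    intro l; induction l <;> simp_all
  rw [this]; rfl

lemma diffOp_C (a : ℝ) (f : MvPolynomial (Fin r) ℝ) : diffOp r (C a) f = a • f := by
  rw [← mul_one (C a), ← smul_eq_C_mul, map_smul, LinearMap.smul_apply, diffOp_one]

lemma diffOp_mul (p q f : MvPolynomial (Fin r) ℝ) :
    diffOp r (p * q) f = diffOp r p (diffOp r q f) := by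
  induction q using MvPolynomial.induction_on generalizing p f with
  | C a => rw [diffOp_C, mul_comm, ← smul_eq_C_mul]; simp
  | add q q' h h' => simp [mul_add, h, h']
  | mul_X q i h => rw [← mul_assoc, diffOp_mul_X, diffOp_mul_X, h]

lemma diffOp_linPoly (x : Fin r → ℝ) (f : MvPolynomial (Fin r) ℝ) :
    diffOp r (linPoly x) f = dirD x f := by
  have h : ∀ j, diffOp r (X j) f = pderiv j f := fun j => by
    rw [← one_mul (X j), diffOp_mul_X, diffOp_one]
  simp [linPoly, ← smul_eq_C_mul, dirD_eq_sum, h]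

lemma pairing_apply (p f : MvPolynomial (Fin r) ℝ) :
    pairing r p f = eval 0 (diffOp r p f) := by
  simp [pairing, LinearMap.compr₂_apply]

lemma pairing_mul (p q f : MvPolynomial (Fin r) ℝ) :
    pairing r (p * q) f = pairing r p (diffOp r q f) := by
  rw [pairing_apply, pairing_apply, diffOp_mul]

/-- Induction on the degree: the partial derivatives inherit the hypothesis through `q * X i`, so
they vanish and `f` is a constant, which is detected by `q = 1`. -/
lemma eq_zero_of_pairing_eq_zero {f : MvPolynomial (Fin r) ℝ}
    (h : ∀ q, pairing r q f = 0) : f = 0 := by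
  obtain ⟨n, hn⟩ : ∃ n, f.totalDegree < n := ⟨_, Nat.lt_succ_self _⟩
  induction n generalizing f with
  | zero => simp at hn
  | succ n ih =>
    have h0 : eval 0 f = 0 := by simpa [pairing_apply, diffOp_one] using h 1
    have hd : ∀ i, pderiv i f = 0 := by
      intro i
      by_cases hf : f.totalDegree = 0
      · rw [totalDegree_eq_zero_iff_eq_C.1 hf, pderiv_C]
      refine ih (fun q => ?_) ?_
      · have := h (q * X i)
        rwa [pairing_apply, diffOp_mul_X, ← pairing_apply] at this
      · refine lt_of_le_of_lt (Finset.sup_le (a := f.totalDegree - 1) fun m hm => ?_) (by omega)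
        rw [mem_support_iff, coeff_pderiv] at hm
        have := le_totalDegree (p := f) (s := m + Finsupp.single i 1)
          (mem_support_iff.2 (left_ne_zero_of_mul hm))
        rw [Finsupp.sum_add_index' (by simp) (by simp), Finsupp.sum_single_index rfl] at this
        omega
    rw [eq_C_of_dirD_eq_zero (f := f) fun x => by simp [dirD_eq_sum, hd], h0, C_0]

/-- Each linear factor lowers the degree by one, so fewer than `n` of them leave a form of positive
degree, which vanishes at the origin. -/
lemma pairing_eq_zero_of_isHomogeneous {f : MvPolynomial (Fin r) ℝ} {n : ℕ}
    (hf : f.IsHomogeneous n) (X : Fin N → Fin r → ℝ) (Y : Finset (Fin N)) (h : Y.card < n) :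
    pairing r (prodPoly X Y) f = 0 := by
  induction Y using Finset.induction_on generalizing f n with
  | empty =>
    rw [prodPoly, Finset.prod_empty, pairing_apply, diffOp_one]
    by_contra h0
    have h1 : coeff 0 f ≠ 0 := by rwa [← constantCoeff_eq, ← eval_zero]
    have := hf h1
    simp at this
    simp at h
    omega
  | insert a Y ha ih =>
    rw [prodPoly, Finset.prod_insert ha, mul_comm, pairing_mul]
    rw [Finset.card_insert_of_notMem ha] at h
    change pairing r (prodPoly X Y) (diffOp r (linPoly (X a)) f) = 0
    rw [diffOp_linPoly]
    exact ih (IsHomogeneous.dirD hf _) (by omega)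

/-! ### Antiderivatives along a direction, vanishing on a transversal hyperplane -/

lemma dirD_linPoly (x y : Fin r → ℝ) : dirD x (linPoly y) = C (∑ j, y j * x j) := by
  simp [linPoly]

/-- A linear functional on `ℝ^r` as a linear form. -/
def dualPoly (t : Module.Dual ℝ (Fin r → ℝ)) : MvPolynomial (Fin r) ℝ :=
  linPoly fun j => t (Pi.single j 1)

lemma sum_dual_mul (t : Module.Dual ℝ (Fin r → ℝ)) (u : Fin r → ℝ) :
    ∑ j, t (Pi.single j 1) * u j = t u := by
  conv_rhs => rw [LinearMap.pi_apply_eq_sum_univ t u]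
  refine Finset.sum_congr rfl fun j _ => ?_
  rw [mul_comm, smul_eq_mul]
  congr 2
  ext i
  simp [Pi.single_apply, eq_comm]

lemma eval_dualPoly (t : Module.Dual ℝ (Fin r → ℝ)) (u : Fin r → ℝ) :
    eval u (dualPoly t) = t u := by
  simp [dualPoly, linPoly, sum_dual_mul]

lemma dirD_dualPoly (t : Module.Dual ℝ (Fin r → ℝ)) (x : Fin r → ℝ) :
    dirD x (dualPoly t) = C (t x) := by
  rw [dualPoly, dirD_linPoly, sum_dual_mul]

lemma isHomogeneous_dualPoly (t : Module.Dual ℝ (Fin r → ℝ)) :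
    (dualPoly t).IsHomogeneous 1 :=
  IsHomogeneous.sum _ _ _ fun j _ => by
    simpa using (isHomogeneous_C (Fin r) _).mul (isHomogeneous_X ℝ j)

/-- Integration by parts: `t^(k+1) F / ((k+1) t(x))` is an antiderivative of `t^k F` up to a term
with `t^(k+1) D_x F`. The power of `t` grows while the degree of `F` drops, hence the general `k`.
Divisibility by `t` gives the vanishing on the hyperplane. -/
lemma exists_antideriv_pow_mul {t : Module.Dual ℝ (Fin r → ℝ)} {x : Fin r → ℝ} (h : t x ≠ 0)
    (n : ℕ) (F : MvPolynomial (Fin r) ℝ) (hF : F.IsHomogeneous n) (k : ℕ) :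
    ∃ G : MvPolynomial (Fin r) ℝ, G.IsHomogeneous (n + k + 1) ∧
      dirD x G = dualPoly t ^ k * F ∧ ∀ u, t u = 0 → eval u G = 0 := by
  have hc (k : ℕ) : (((k : ℝ) + 1) * t x) ≠ 0 := mul_ne_zero (by positivity) h
  have hpow (k : ℕ) (G : MvPolynomial (Fin r) ℝ) :
      dirD x (C (((k : ℝ) + 1) * t x)⁻¹ * (dualPoly t ^ (k + 1) * G)) =
      dualPoly t ^ k * G + C (((k : ℝ) + 1) * t x)⁻¹ * (dualPoly t ^ (k + 1) * dirD x G) := by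
    have h1 : (C (((k : ℝ) + 1) * t x)⁻¹ * (C (((k : ℝ) + 1) * t x)) :
        MvPolynomial (Fin r) ℝ) = 1 := by
      rw [← C_mul, inv_mul_cancel₀ (hc k), C_1]
    have h2 : (C (((k : ℝ) + 1) * t x) : MvPolynomial (Fin r) ℝ) =
        ((k : MvPolynomial (Fin r) ℝ) + 1) * C (t x) := by
      simp
    simp only [Derivation.leibniz, Derivation.leibniz_pow, dirD_dualPoly, derivation_C,
      smul_eq_mul, nsmul_eq_mul, Nat.add_sub_cancel, mul_zero, add_zero]
    push_cast
    rw [h2] at h1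
    linear_combination (dualPoly t ^ k * G) * h1
  have hom (k : ℕ) (G : MvPolynomial (Fin r) ℝ) (m : ℕ) (hG : G.IsHomogeneous m) :
      (C (((k : ℝ) + 1) * t x)⁻¹ * (dualPoly t ^ (k + 1) * G)).IsHomogeneous (m + k + 1) := by
    have := (isHomogeneous_C (Fin r) (((k : ℝ) + 1) * t x)⁻¹).mul
      (((isHomogeneous_dualPoly t).pow (k + 1)).mul hG)
    convert this using 1
    ring
  induction n generalizing F k with
  | zero =>
    refine ⟨_, hom k F 0 hF, ?_, fun u hu => by simp [eval_dualPoly, hu]⟩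
    rw [hpow, totalDegree_eq_zero_iff_eq_C.1 ((totalDegree_zero_iff_isHomogeneous _).2 hF)]
    simp
  | succ n ih =>
    obtain ⟨G, hG, hdG, hG0⟩ := ih (dirD x F) (IsHomogeneous.dirD hF x) (k + 1)
    refine ⟨_ - C (((k : ℝ) + 1) * t x)⁻¹ * G, (hom k F _ hF).sub ?_, ?_, fun u hu => ?_⟩
    · rw [show n + 1 + k + 1 = 0 + (n + (k + 1) + 1) by omega]
      exact (isHomogeneous_C (Fin r) (((k : ℝ) + 1) * t x)⁻¹).mul hG
    · rw [map_sub, hpow]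
      simp [hdG]
    · simp [eval_dualPoly, hu, hG0 u hu]

lemma exists_antideriv_of_isHomogeneous {t : Module.Dual ℝ (Fin r → ℝ)} {x : Fin r → ℝ}
    (h : t x ≠ 0) {n : ℕ} {F : MvPolynomial (Fin r) ℝ} (hF : F.IsHomogeneous n) :
    ∃ G : MvPolynomial (Fin r) ℝ, G.IsHomogeneous (n + 1) ∧
      dirD x G = F ∧ ∀ u, t u = 0 → eval u G = 0 := by
  simpa using exists_antideriv_pow_mul h n F hF 0

lemma exists_antideriv {t : Module.Dual ℝ (Fin r → ℝ)} {x : Fin r → ℝ}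
    (h : t x ≠ 0) (F : MvPolynomial (Fin r) ℝ) :
    ∃ G : MvPolynomial (Fin r) ℝ, dirD x G = F ∧ ∀ u, t u = 0 → eval u G = 0 := by
  choose G _ hG hG0 using fun n =>
    exists_antideriv_of_isHomogeneous h (homogeneousComponent_isHomogeneous n F)
  refine ⟨∑ n ∈ Finset.range (F.totalDegree + 1), G n, ?_, fun u hu => ?_⟩
  · rw [map_sum, Finset.sum_congr rfl fun n _ => hG n, sum_homogeneousComponent]
  · rw [map_sum, Finset.sum_eq_zero fun n _ => hG0 n u hu]

/-- The antiderivative of `F` along `x` that vanishes on the hyperplane `t = 0`. -/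
def antideriv (t : Module.Dual ℝ (Fin r → ℝ)) (x : Fin r → ℝ) (F : MvPolynomial (Fin r) ℝ) :
    MvPolynomial (Fin r) ℝ :=
  if h : t x ≠ 0 then (exists_antideriv h F).choose else 0

section antideriv

variable {t : Module.Dual ℝ (Fin r → ℝ)} {x : Fin r → ℝ}

lemma dirD_antideriv (h : t x ≠ 0) (F : MvPolynomial (Fin r) ℝ) :
    dirD x (antideriv t x F) = F := by
  rw [antideriv, dif_pos h]
  exact (exists_antideriv h F).choose_spec.1

lemma eval_antideriv (h : t x ≠ 0) (F : MvPolynomial (Fin r) ℝ) {u : Fin r → ℝ} (hu : t u = 0) :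
    eval u (antideriv t x F) = 0 := by
  rw [antideriv, dif_pos h]
  exact (exists_antideriv h F).choose_spec.2 u hu

/-- The difference of two candidates is constant along `x`, and every line in direction `x` meets
the hyperplane `t = 0`, where both vanish. -/
lemma antideriv_unique (h : t x ≠ 0) {F G : MvPolynomial (Fin r) ℝ} (hG : dirD x G = F)
    (hG0 : ∀ u, t u = 0 → eval u G = 0) : antideriv t x F = G := by
  refine MvPolynomial.funext fun u => ?_
  have h1 : dirD x (antideriv t x F - G) = 0 := by
    rw [map_sub, dirD_antideriv h, hG, sub_self]
  -- This is the point where the line through `u` in direction `x` meets the hyperplane.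
  have h2 : t (u + (-(t u / t x)) • x) = 0 := by
    simp [h]
  have h3 := eval_add_smul_of_dirD_eq_zero h1 u (-(t u / t x))
  rw [map_sub, eval_antideriv h F h2, hG0 _ h2, map_sub] at h3
  linarith

lemma antideriv_isHomogeneous (h : t x ≠ 0) {n : ℕ} {F : MvPolynomial (Fin r) ℝ}
    (hF : F.IsHomogeneous n) : (antideriv t x F).IsHomogeneous (n + 1) := by
  obtain ⟨G, hG, hdG, hG0⟩ := exists_antideriv_of_isHomogeneous h hF
  rwa [antideriv_unique h hdG hG0]

/-- Since `y` is tangent to the hyperplane `t = 0`, differentiating along `y` preserves vanishing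
there, and uniqueness applies. -/
lemma dirD_antideriv_comm (h : t x ≠ 0) {y : Fin r → ℝ} (hy : t y = 0)
    (F : MvPolynomial (Fin r) ℝ) : dirD y (antideriv t x F) = antideriv t x (dirD y F) := by
  refine (antideriv_unique h ?_ fun u hu => ?_).symm
  · rw [dirD_comm, dirD_antideriv h]
  · have h1 : (fun s : ℝ => eval (u + s • y) (antideriv t x F)) = fun _ => 0 :=
      funext fun s => eval_antideriv h F (by simp [hu, hy])
    have h2 := hasDerivAt_eval u y (antideriv t x F) 0
    rw [h1] at h2
    simpa using h2.unique (hasDerivAt_const _ _)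

lemma antideriv_smul (h : t x ≠ 0) (c : ℝ) (F : MvPolynomial (Fin r) ℝ) :
    antideriv t x (c • F) = c • antideriv t x F :=
  antideriv_unique h (by rw [Derivation.map_smul, dirD_antideriv h])
    fun u hu => by rw [smul_eval, eval_antideriv h F hu, mul_zero]

lemma antideriv_neg (h : t x ≠ 0) (F : MvPolynomial (Fin r) ℝ) :
    antideriv t (-x) F = -antideriv t x F :=
  antideriv_unique (by simpa using h)
    (by rw [dirD_neg, map_neg, dirD_antideriv h, neg_neg])
    fun u hu => by rw [map_neg, eval_antideriv h F hu, neg_zero]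

lemma antideriv_neg_dual (h : t x ≠ 0) (F : MvPolynomial (Fin r) ℝ) :
    antideriv (-t) x F = antideriv t x F :=
  antideriv_unique (by simpa using h) (dirD_antideriv h F)
    fun u hu => eval_antideriv h F (by simpa using hu)

end antideriv

/-- The iterated antiderivative along the vectors of a list. -/
def antiderivs (t : Module.Dual ℝ (Fin r → ℝ)) (L : List (Fin r → ℝ))
    (F : MvPolynomial (Fin r) ℝ) : MvPolynomial (Fin r) ℝ :=
  L.foldl (fun F x => antideriv t x F) F

section antiderivs

variable {t : Module.Dual ℝ (Fin r → ℝ)}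

@[simp] lemma antiderivs_nil (F : MvPolynomial (Fin r) ℝ) : antiderivs t [] F = F := rfl

@[simp] lemma antiderivs_cons (x : Fin r → ℝ) (L : List (Fin r → ℝ))
    (F : MvPolynomial (Fin r) ℝ) :
    antiderivs t (x :: L) F = antiderivs t L (antideriv t x F) := rfl

lemma antiderivs_isHomogeneous {L : List (Fin r → ℝ)} (hL : ∀ x ∈ L, t x ≠ 0) {n : ℕ}
    {F : MvPolynomial (Fin r) ℝ} (hF : F.IsHomogeneous n) :
    (antiderivs t L F).IsHomogeneous (n + L.length) := by
  induction L generalizing F n with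
  | nil => exact hF
  | cons x L ih =>
    rw [List.length_cons, ← Nat.add_assoc, Nat.add_right_comm]
    exact ih (fun y hy => hL y (.tail _ hy)) (antideriv_isHomogeneous (hL x (.head _)) hF)

lemma dirD_antiderivs_comm {L : List (Fin r → ℝ)} (hL : ∀ x ∈ L, t x ≠ 0) {y : Fin r → ℝ}
    (hy : t y = 0) (F : MvPolynomial (Fin r) ℝ) :
    dirD y (antiderivs t L F) = antiderivs t L (dirD y F) := by
  induction L generalizing F with
  | nil => rfl
  | cons x L ih =>
    rw [antiderivs_cons, ih (fun y hy => hL y (.tail _ hy)),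
      dirD_antideriv_comm (hL x (.head _)) hy, antiderivs_cons]

lemma antiderivs_smul {L : List (Fin r → ℝ)} (hL : ∀ x ∈ L, t x ≠ 0) (c : ℝ)
    (F : MvPolynomial (Fin r) ℝ) : antiderivs t L (c • F) = c • antiderivs t L F := by
  induction L generalizing F with
  | nil => rfl
  | cons x L ih =>
    rw [antiderivs_cons, antideriv_smul (hL x (.head _)), ih (fun y hy => hL y (.tail _ hy)),
      antiderivs_cons]

lemma antiderivs_map_neg {L : List (Fin r → ℝ)} (hL : ∀ x ∈ L, t x ≠ 0)
    (F : MvPolynomial (Fin r) ℝ) :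
    antiderivs t (L.map Neg.neg) F = (-1 : ℝ) ^ L.length • antiderivs t L F := by
  induction L generalizing F with
  | nil => simp
  | cons x L ih =>
    have hL' : ∀ y ∈ L, t y ≠ 0 := fun y hy => hL y (.tail _ hy)
    rw [List.map_cons, antiderivs_cons, antideriv_neg (hL x (.head _)), ih hL',
      antiderivs_cons, ← neg_one_smul ℝ (antideriv t x F), antiderivs_smul hL', smul_smul,
      List.length_cons, pow_succ]

lemma antiderivs_neg_dual {L : List (Fin r → ℝ)} (hL : ∀ x ∈ L, t x ≠ 0)
    (F : MvPolynomial (Fin r) ℝ) : antiderivs (-t) L F = antiderivs t L F := by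
  induction L generalizing F with
  | nil => rfl
  | cons x L ih =>
    rw [antiderivs_cons, antideriv_neg_dual (hL x (.head _)), ih (fun y hy => hL y (.tail _ hy)),
      antiderivs_cons]

lemma antiderivs_append (L L' : List (Fin r → ℝ)) (F : MvPolynomial (Fin r) ℝ) :
    antiderivs t (L ++ L') F = antiderivs t L' (antiderivs t L F) :=
  List.foldl_append

lemma diffOp_antiderivs {L : List (Fin r → ℝ)} (hL : ∀ x ∈ L, t x ≠ 0)
    (F : MvPolynomial (Fin r) ℝ) :
    diffOp r (L.map linPoly).prod (antiderivs t L F) = F := by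
  induction L using List.reverseRecOn generalizing F with
  | nil => simp [diffOp_one]
  | append_singleton L x ih =>
    rw [List.map_append, List.prod_append, diffOp_mul, antiderivs_append]
    simp only [List.map_cons, List.map_nil, List.prod_singleton, antiderivs_cons,
      antiderivs_nil, diffOp_linPoly]
    rw [dirD_antideriv (hL x (by simp)), ih fun y hy => hL y (by simp [hy])]

end antiderivs

/-! ### Coordinates with respect to a basis, and the blocks of a basis -/

/-- The coordinate functional of `b` with respect to the basis `B`. -/
def coord (X : Fin N → Fin r → ℝ) (B : Finset (Fin N)) (b : Fin N) :
    Module.Dual ℝ (Fin r → ℝ) :=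
  if h : IsBasis X B ∧ b ∈ B then
    (Module.Basis.mk h.1.1 (by
      have h2 := h.1.2
      rw [← h2, Set.image_eq_range]; rfl)).coord ⟨b, h.2⟩
  else 0

/-- The elements outside of `E(B)` that lie in `Sᵢ ∖ Sᵢ₋₁`, for `b = bᵢ`. -/
def block (X : Fin N → Fin r → ℝ) (B : Finset (Fin N)) (b : Fin N) : Finset (Fin N) :=
  (Finset.univ \ extActive X B).filter fun z => X z ∈ flagLE X B b ∧ X z ∉ flagLT X B b

lemma flagLE_mono (X : Fin N → Fin r → ℝ) (B : Finset (Fin N)) {b c : Fin N} (h : b ≤ c) :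
    flagLE X B b ≤ flagLE X B c :=
  Submodule.span_mono (Set.image_mono fun _ hx => ⟨hx.1, hx.2.trans h⟩)

/-- The closure of `B` from below, `B ∪ E(B)`. -/
lemma mem_union_extActive {X : Fin N → Fin r → ℝ} {B : Finset (Fin N)} {x : Fin N} :
    x ∈ B ∪ extActive X B ↔ X x ∈ flagLE X B x := by
  by_cases h : x ∈ B
  · simp only [Finset.mem_union, h, true_or, true_iff]
    exact Submodule.subset_span ⟨x, ⟨h, le_rfl⟩, rfl⟩
  · simp [extActive, h]

section coord

variable {X : Fin N → Fin r → ℝ} {B : Finset (Fin N)}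

lemma coord_apply (hB : IsBasis X B) {b c : Fin N} (hb : b ∈ B) (hc : c ∈ B) :
    coord X B b (X c) = if b = c then 1 else 0 := by
  rw [coord, dif_pos ⟨hB, hb⟩]
  have h : X c = Module.Basis.mk hB.1 (by
      have h2 := hB.2
      rw [← h2, Set.image_eq_range]; rfl) ⟨c, hc⟩ := by
    rw [Module.Basis.mk_apply]
  conv_lhs => rw [h]
  rw [Module.Basis.coord_apply, Module.Basis.repr_self, Finsupp.single_apply]
  simp [Subtype.ext_iff, eq_comm]

lemma sum_coord (hB : IsBasis X B) (u : Fin r → ℝ) :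
    ∑ c ∈ B, coord X B c u • X c = u := by
  have h := (Module.Basis.mk hB.1 (by
      have h2 := hB.2
      rw [← h2, Set.image_eq_range]; rfl)).sum_repr u
  rw [← Finset.sum_coe_sort]
  conv_rhs => rw [← h]
  refine Finset.sum_congr rfl fun c _ => ?_
  rw [Module.Basis.mk_apply, coord, dif_pos ⟨hB, c.2⟩]
  rfl

lemma mem_span_image_iff (hB : IsBasis X B) (P : Fin N → Prop) {u : Fin r → ℝ} :
    u ∈ Submodule.span ℝ (X '' {c | c ∈ B ∧ P c}) ↔ ∀ c ∈ B, ¬ P c → coord X B c u = 0 := by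
  constructor
  · intro hu c hc hPc
    have : Submodule.span ℝ (X '' {c | c ∈ B ∧ P c}) ≤ LinearMap.ker (coord X B c) := by
      rw [Submodule.span_le]
      rintro _ ⟨d, ⟨hd, hPd⟩, rfl⟩
      have : c ≠ d := fun h => hPc (h ▸ hPd)
      simp [coord_apply hB hc hd, this]
    exact this hu
  · intro h
    rw [← sum_coord hB u]
    refine Submodule.sum_mem _ fun c hc => ?_
    by_cases hPc : P c
    · exact Submodule.smul_mem _ _ (Submodule.subset_span ⟨c, ⟨hc, hPc⟩, rfl⟩)
    · rw [h c hc hPc, zero_smul]; exact Submodule.zero_mem _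

lemma mem_flagLE_iff (hB : IsBasis X B) {b : Fin N} {u : Fin r → ℝ} :
    u ∈ flagLE X B b ↔ ∀ c ∈ B, b < c → coord X B c u = 0 := by
  simp [flagLE, mem_span_image_iff hB]

lemma mem_flagLT_iff (hB : IsBasis X B) {b : Fin N} {u : Fin r → ℝ} :
    u ∈ flagLT X B b ↔ ∀ c ∈ B, b ≤ c → coord X B c u = 0 := by
  simp [flagLT, mem_span_image_iff hB]

lemma mem_flagLT_iff_of_mem (hB : IsBasis X B) {b : Fin N} (hb : b ∈ B) {u : Fin r → ℝ}
    (hu : u ∈ flagLE X B b) : u ∈ flagLT X B b ↔ coord X B b u = 0 := by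
  rw [mem_flagLT_iff hB]
  refine ⟨fun h => h b hb le_rfl, fun h c hc hbc => ?_⟩
  rcases hbc.eq_or_lt with rfl | hlt
  · exact h
  · exact (mem_flagLE_iff hB).1 hu c hc hlt

lemma sub_coord_smul_mem_flagLT (hB : IsBasis X B) {b : Fin N} (hb : b ∈ B) {u : Fin r → ℝ}
    (hu : u ∈ flagLE X B b) : u - coord X B b u • X b ∈ flagLT X B b := by
  rw [mem_flagLT_iff hB]
  intro c hc hbc
  rw [map_sub, map_smul, coord_apply hB hc hb]
  rcases hbc.eq_or_lt with rfl | hlt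
  · simp
  · simp [(mem_flagLE_iff hB).1 hu c hc hlt, hlt.ne']

lemma isPositive_iff (hB : IsBasis X B) {b : Fin N} (hb : b ∈ B) {u : Fin r → ℝ}
    (hu : u ∈ flagLE X B b) : IsPositive X B b u ↔ 0 < coord X B b u := by
  constructor
  · rintro ⟨c, hc, h⟩
    have := (mem_flagLT_iff hB).1 h b hb le_rfl
    rw [map_sub, map_smul, coord_apply hB hb hb, if_pos rfl, smul_eq_mul, mul_one,
      sub_eq_zero] at this
    rwa [this]
  · exact fun h => ⟨_, h, sub_coord_smul_mem_flagLT hB hb hu⟩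

lemma mem_block_iff (hB : IsBasis X B) {b : Fin N} (hb : b ∈ B) {z : Fin N} :
    z ∈ block X B b ↔ z ∉ extActive X B ∧ X z ∈ flagLE X B b ∧ coord X B b (X z) ≠ 0 := by
  rw [block, Finset.mem_filter, Finset.mem_sdiff]
  simp only [Finset.mem_univ, true_and]
  refine and_congr_right fun _ => and_congr_right fun h => ?_
  rw [mem_flagLT_iff_of_mem hB hb h]

lemma self_mem_block (hB : IsBasis X B) {b : Fin N} (hb : b ∈ B) : b ∈ block X B b := by
  rw [mem_block_iff hB hb]
  refine ⟨by simp [extActive, hb], Submodule.subset_span ⟨b, ⟨hb, le_rfl⟩, rfl⟩, ?_⟩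
  simp [coord_apply hB hb hb]

lemma eq_of_mem_block_of_mem (hB : IsBasis X B) {b z : Fin N} (hb : b ∈ B)
    (h : z ∈ block X B b) (hz : z ∈ B) : z = b := by
  rw [mem_block_iff hB hb, coord_apply hB hb hz] at h
  by_contra hne
  exact h.2.2 (if_neg (Ne.symm hne))

/-- An element of `Sᵢ` that comes after `bᵢ` and is not in `B` is externally active, and blocks
exclude such elements. -/
lemma le_of_mem_block (hB : IsBasis X B) {b z : Fin N} (hb : b ∈ B)
    (h : z ∈ block X B b) : z ≤ b := by
  by_contra hlt
  push Not at hlt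
  have hz : z ∉ B := fun hz => hlt.ne' (eq_of_mem_block_of_mem hB hb h hz)
  rw [mem_block_iff hB hb] at h
  exact h.1 (by simpa [extActive, hz] using flagLE_mono X B hlt.le h.2.1)

/-- The block is that of the largest `b ∈ B` at which `z` has a nonzero coordinate. -/
lemma exists_mem_block (hB : IsBasis X B) {z : Fin N} (hz : z ∉ extActive X B) :
    ∃ b ∈ B, z ∈ block X B b := by
  have hne : (B.filter fun b => coord X B b (X z) ≠ 0).Nonempty := by
    by_contra h
    rw [Finset.not_nonempty_iff_eq_empty, Finset.filter_eq_empty_iff] at h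
    push Not at h
    by_cases hzB : z ∈ B
    · simpa [coord_apply hB hzB hzB] using h hzB
    · refine hz ?_
      simp only [extActive, Finset.mem_filter, Finset.mem_univ, true_and]
      exact ⟨hzB, (mem_flagLE_iff hB).2 fun c hc _ => h hc⟩
  have hmem := Finset.max'_mem _ hne
  rw [Finset.mem_filter] at hmem
  refine ⟨_, hmem.1, (mem_block_iff hB hmem.1).2 ⟨hz, (mem_flagLE_iff hB).2 fun c hc hlt => ?_,
    hmem.2⟩⟩
  by_contra hc0
  exact absurd (Finset.le_max' _ c (Finset.mem_filter.2 ⟨hc, hc0⟩)) (not_le.2 hlt)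

lemma block_unique (hB : IsBasis X B) {b c z : Fin N} (hb : b ∈ B) (hc : c ∈ B)
    (h : z ∈ block X B b) (h' : z ∈ block X B c) : b = c := by
  rw [mem_block_iff hB hb, mem_flagLE_iff hB] at h
  rw [mem_block_iff hB hc, mem_flagLE_iff hB] at h'
  rcases lt_trichotomy b c with hlt | heq | hlt
  · exact absurd (h.2.1 c hc hlt) h'.2.2
  · exact heq
  · exact absurd (h'.2.1 b hb hlt) h.2.2

/-- A family with one element in each block is related to the basis by a triangular matrix. -/
lemma mem_of_mem_block_mem (hB : IsBasis X B) {z : Fin N → Fin N}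
    (hz : ∀ c ∈ B, z c ∈ block X B c) {W : Submodule ℝ (Fin r → ℝ)} {b : Fin N}
    (h : ∀ c ∈ B, c ≤ b → X (z c) ∈ W) (c : Fin N) (hc : c ∈ B) (hcb : c ≤ b) : X c ∈ W := by
  induction c using WellFoundedLT.induction with
  | ind c ih =>
    obtain ⟨_, h1, h2⟩ := (mem_block_iff hB hc).1 (hz c hc)
    have h3 : X (z c) - coord X B c (X (z c)) • X c ∈ W := by
      have : flagLT X B c ≤ W := by
        rw [flagLT, Submodule.span_le]
        rintro _ ⟨d, ⟨hd, hdc⟩, rfl⟩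
        exact ih d hdc hd (hdc.le.trans hcb)
      exact this (sub_coord_smul_mem_flagLT hB hc h1)
    have h4 := W.sub_mem (h c hc hcb) h3
    rw [sub_sub_cancel] at h4
    exact (W.smul_mem_iff h2).1 h4

/-- A basis `B` is determined by `B ∪ E(B)`. -/
lemma eq_of_union_extActive_eq {D : Finset (Fin N)} (hB : IsBasis X B) (hD : IsBasis X D)
    (h : B ∪ extActive X B = D ∪ extActive X D) : B = D := by
  -- `B` is recovered greedily from `B ∪ E(B)`, as the elements outside the span of their
  -- predecessors in that set. The predecessors of `x` in `B ∪ E(B)` and those in `B` have the same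
  -- span.
  have key : ∀ {B : Finset (Fin N)}, IsBasis X B → ∀ x, x ∈ B ↔ x ∈ B ∪ extActive X B ∧
      X x ∉ Submodule.span ℝ (X '' {c | c ∈ B ∪ extActive X B ∧ c < x}) := by
    intro B hB x
    have hs : Submodule.span ℝ (X '' {c | c ∈ B ∪ extActive X B ∧ c < x}) = flagLT X B x := by
      refine le_antisymm ?_ (Submodule.span_mono (Set.image_mono fun c hc =>
        ⟨Finset.mem_union_left _ hc.1, hc.2⟩))
      rw [Submodule.span_le]
      rintro _ ⟨c, ⟨hc, hcx⟩, rfl⟩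
      refine Submodule.span_mono (Set.image_mono fun d hd => ?_) (mem_union_extActive.1 hc)
      exact ⟨hd.1, hd.2.trans_lt hcx⟩
    rw [hs]
    refine ⟨fun hx => ⟨Finset.mem_union_left _ hx, fun h => ?_⟩, fun ⟨hx, hx'⟩ => ?_⟩
    · have := (mem_flagLT_iff hB).1 h x hx le_rfl
      simp [coord_apply hB hx hx] at this
    · by_contra hxB
      refine hx' (Submodule.span_mono (Set.image_mono fun d hd => ?_) (mem_union_extActive.1 hx))
      exact ⟨hd.1, lt_of_le_of_ne hd.2 fun h => hxB (h ▸ hd.1)⟩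
  ext x
  rw [key hB, key hD, h]

/-- The chosen block elements satisfy `z b ≤ b` and are related to `D` by a triangular matrix with
nonzero diagonal. Hence the span of the elements of `D` up to `x` lies in the span of those of `B`
up to `x`, and by `mem_union_extActive` this decides membership. -/
lemma union_extActive_subset {D : Finset (Fin N)} (hD : IsBasis X D)
    (h : ∀ b ∈ D, ∃ z ∈ block X D b, z ∈ B ∪ extActive X B) :
    D ∪ extActive X D ⊆ B ∪ extActive X B := by
  choose! z hz hzB using h
  intro x hx
  rw [mem_union_extActive] at hx ⊢
  have hle : flagLE X D x ≤ flagLE X B x := by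
    rw [flagLE, Submodule.span_le]
    rintro _ ⟨c, ⟨hc, hcx⟩, rfl⟩
    refine mem_of_mem_block_mem hD hz (b := x) (fun d hd hdx => ?_) c hc hcx
    exact flagLE_mono X B ((le_of_mem_block hD hd (hz d hd)).trans hdx)
      (mem_union_extActive.1 (hzB d hd))
  exact hle hx

end coord

/-! ### The polynomials `|det B| R^B` -/

/-- The elements of the block of `b` other than `b`, positive ones first. -/
def blockList (X : Fin N → Fin r → ℝ) (B : Finset (Fin N)) (b : Fin N) : List (Fin N) :=
  ((posPart X (Finset.univ \ extActive X B) B b).erase b).toList ++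
    (negPart X (Finset.univ \ extActive X B) B b).toList

/-- The effect of convolution with the factor `Rᵢ` on polynomials, for `b = bᵢ`. -/
def blockPoly (X : Fin N → Fin r → ℝ) (B : Finset (Fin N)) (F : MvPolynomial (Fin r) ℝ)
    (b : Fin N) : MvPolynomial (Fin r) ℝ :=
  antiderivs (coord X B b) ((blockList X B b).map X) F

/-- The polynomial `|det B| R^B`. -/
def polyF (X : Fin N → Fin r → ℝ) (B : Finset (Fin N)) : MvPolynomial (Fin r) ℝ :=
  (B.sort (· ≤ ·)).foldl (blockPoly X B) 1

section polyF

variable {X : Fin N → Fin r → ℝ} {B : Finset (Fin N)}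

lemma mem_blockList {b z : Fin N} :
    z ∈ blockList X B b ↔ z ∈ block X B b ∧ z ≠ b := by
  have hpos : IsPositive X B b (X b) := ⟨1, one_pos, by simp⟩
  simp only [blockList, posPart, negPart, block, List.mem_append, Finset.mem_toList,
    Finset.mem_erase, Finset.mem_filter]
  by_cases hzb : z = b
  · subst hzb; simp [hpos]
  · tauto

lemma nodup_blockList (b : Fin N) : (blockList X B b).Nodup := by
  rw [blockList, List.nodup_append']
  refine ⟨Finset.nodup_toList _, Finset.nodup_toList _, fun z hz hz' => ?_⟩
  simp only [posPart, negPart, Finset.mem_toList, Finset.mem_erase, Finset.mem_filter] at hz hz'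
  exact hz'.2.2.2 hz.2.2.2.2

lemma coord_ne_zero_of_mem_blockList (hB : IsBasis X B) {b : Fin N} (hb : b ∈ B)
    (x : Fin r → ℝ) (hx : x ∈ (blockList X B b).map X) : coord X B b x ≠ 0 := by
  obtain ⟨z, hz, rfl⟩ := List.mem_map.1 hx
  exact ((mem_block_iff hB hb).1 ((mem_blockList).1 hz).1).2.2

/-- The vector `y` is tangent to all hyperplanes on which the antiderivatives of these stages are
normalised. -/
lemma dirD_foldl_blockPoly (hB : IsBasis X B) {l : List (Fin N)} (hl : ∀ b ∈ l, b ∈ B)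
    {y : Fin r → ℝ} (hy : ∀ b ∈ l, coord X B b y = 0) (F : MvPolynomial (Fin r) ℝ) :
    dirD y (l.foldl (blockPoly X B) F) = l.foldl (blockPoly X B) (dirD y F) := by
  induction l generalizing F with
  | nil => rfl
  | cons b l ih =>
    rw [List.foldl_cons, ih (fun c hc => hl c (.tail _ hc)) (fun c hc => hy c (.tail _ hc)),
      List.foldl_cons, blockPoly, dirD_antiderivs_comm
        (coord_ne_zero_of_mem_blockList hB (hl b (.head _))) (hy b (.head _))]
    rfl

lemma foldl_blockPoly_zero (hB : IsBasis X B) {l : List (Fin N)} (hl : ∀ b ∈ l, b ∈ B) :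
    l.foldl (blockPoly X B) 0 = 0 := by
  induction l with
  | nil => rfl
  | cons b l ih =>
    have := antiderivs_smul (coord_ne_zero_of_mem_blockList hB (hl b (.head _))) 0 0
    rw [zero_smul, zero_smul] at this
    rw [List.foldl_cons, blockPoly, this, ih fun c hc => hl c (.tail _ hc)]

lemma diffOp_prod_foldl_blockPoly (hB : IsBasis X B) {l : List (Fin N)} (hl : ∀ b ∈ l, b ∈ B)
    (s : List (Fin N)) (hs : ∀ z ∈ s, ∀ b ∈ l, coord X B b (X z) = 0)
    (F : MvPolynomial (Fin r) ℝ) :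
    diffOp r (s.map fun z => linPoly (X z)).prod (l.foldl (blockPoly X B) F) =
      l.foldl (blockPoly X B) (diffOp r (s.map fun z => linPoly (X z)).prod F) := by
  induction s with
  | nil => simp [diffOp_one]
  | cons z s ih =>
    rw [List.map_cons, List.prod_cons, diffOp_mul, ih fun z hz => hs z (.tail _ hz),
      diffOp_linPoly, dirD_foldl_blockPoly hB hl (hs z (.head _)), diffOp_mul, diffOp_linPoly]

lemma prodPoly_eq_prod_linPoly (Y : Finset (Fin N)) :
    prodPoly X Y = ∏ x ∈ Y, linPoly (X x) := rfl

lemma diffOp_prodPoly_insert {Y : Finset (Fin N)} {x : Fin N} (hx : x ∉ Y)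
    (f : MvPolynomial (Fin r) ℝ) :
    diffOp r (prodPoly X (insert x Y)) f = diffOp r (prodPoly X Y) (dirD (X x) f) := by
  rw [prodPoly_eq_prod_linPoly, Finset.prod_insert hx, mul_comm, diffOp_mul, diffOp_linPoly]
  rfl

/-- The vectors of the block of `b` have zero coordinates at later basis elements, so their
derivatives pass through the later stages. Those other than `b` undo the stage of `b`; the
derivative along `b` that is left over passes through the earlier stages and kills the constant `1`.
-/
lemma diffOp_prodPoly_polyF_of_block_subset (hB : IsBasis X B) {b : Fin N} (hb : b ∈ B)
    {C : Finset (Fin N)} (hC : block X B b ⊆ C) : diffOp r (prodPoly X C) (polyF X B) = 0 := by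
  have h1 : prodPoly X C = prodPoly X (C \ block X B b) *
      ((blockList X B b ++ [b]).map fun z => linPoly (X z)).prod := by
    have hnd : (blockList X B b ++ [b]).Nodup := by
      rw [List.nodup_append']
      refine ⟨nodup_blockList b, List.nodup_singleton b, ?_⟩
      simp [mem_blockList]
    have hset : (blockList X B b ++ [b]).toFinset = block X B b := by
      ext z
      simp only [List.mem_toFinset, List.mem_append, List.mem_singleton, mem_blockList]
      constructor
      · rintro (h | rfl)
        · exact h.1
        · exact self_mem_block hB hb
      · tauto
    rw [prodPoly_eq_prod_linPoly, prodPoly_eq_prod_linPoly, ← List.prod_toFinset _ hnd, hset,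
      Finset.prod_sdiff hC]
  obtain ⟨pre, suf, hl⟩ := List.append_of_mem ((Finset.mem_sort (· ≤ ·)).2 hb)
  have hsort : (pre ++ b :: suf).Pairwise (· < ·) := hl ▸ Finset.sortedLT_sort B |>.pairwise
  rw [List.pairwise_append, List.pairwise_cons] at hsort
  have hmem : ∀ c ∈ pre ++ b :: suf, c ∈ B := fun c hc => by
    rwa [← hl, Finset.mem_sort] at hc
  rw [h1, diffOp_mul, polyF, hl, List.foldl_append, List.foldl_cons, diffOp_prod_foldl_blockPoly hB
    (fun c hc => hmem c (by simp [hc]))]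
  -- The commutation makes the derivatives along the other block elements act first, so that the one
  -- along `b` meets the earlier stages only.
  · rw [List.map_append, List.prod_append, mul_comm, diffOp_mul, blockPoly]
    have := diffOp_antiderivs (coord_ne_zero_of_mem_blockList hB hb)
      (pre.foldl (blockPoly X B) 1)
    rw [List.map_map] at this
    erw [this]
    rw [List.map_singleton, List.prod_singleton, diffOp_linPoly, dirD_foldl_blockPoly hB
      (fun c hc => hmem c (by simp [hc])), (dirD (X b)).map_one_eq_zero,
      foldl_blockPoly_zero hB (fun c hc => hmem c (by simp [hc])),
      foldl_blockPoly_zero hB (fun c hc => hmem c (by simp [hc])), map_zero]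
    intro c hc
    rw [coord_apply hB (hmem c (by simp [hc])) hb, if_neg (hsort.2.2 c hc b (by simp)).ne]
  · intro z hz c hc
    have hzb : z ∈ block X B b := by
      rcases List.mem_append.1 hz with hz | hz
      · exact ((mem_blockList).1 hz).1
      · rw [List.mem_singleton.1 hz]; exact self_mem_block hB hb
    exact (mem_flagLE_iff hB).1 ((mem_block_iff hB hb).1 hzb).2.1 c (hmem c (by simp [hc]))
      (hsort.2.1.1 c hc)

lemma diffOp_flatMap_foldl_blockPoly (hB : IsBasis X B) {l : List (Fin N)} (hl : ∀ b ∈ l, b ∈ B)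
    (F : MvPolynomial (Fin r) ℝ) :
    diffOp r ((l.flatMap (blockList X B)).map fun z => linPoly (X z)).prod
      (l.foldl (blockPoly X B) F) = F := by
  induction l using List.reverseRecOn generalizing F with
  | nil => simp [diffOp_one]
  | append_singleton l b ih =>
    rw [List.flatMap_append, List.map_append, List.prod_append, diffOp_mul, List.foldl_append]
    have := diffOp_antiderivs (coord_ne_zero_of_mem_blockList hB (hl b (by simp)))
      (l.foldl (blockPoly X B) F)
    rw [List.map_map] at this
    simp only [List.flatMap_singleton, List.foldl_cons, List.foldl_nil]
    erw [this]
    exact ih (fun c hc => hl c (by simp [hc])) F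

lemma foldl_blockPoly_isHomogeneous (hB : IsBasis X B) {l : List (Fin N)} (hl : ∀ b ∈ l, b ∈ B)
    {F : MvPolynomial (Fin r) ℝ} {n : ℕ} (hF : F.IsHomogeneous n) :
    (l.foldl (blockPoly X B) F).IsHomogeneous (n + (l.flatMap (blockList X B)).length) := by
  induction l generalizing F n with
  | nil => exact hF
  | cons b l ih =>
    rw [List.foldl_cons, List.flatMap_cons, List.length_append, ← add_assoc]
    refine ih (fun c hc => hl c (.tail _ hc)) ?_
    have := antiderivs_isHomogeneous (coord_ne_zero_of_mem_blockList hB (hl b (.head _))) hF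
    rwa [List.length_map] at this

lemma nodup_flatMap_blockList (hB : IsBasis X B) :
    ((B.sort (· ≤ ·)).flatMap (blockList X B)).Nodup := by
  rw [List.nodup_flatMap]
  refine ⟨fun b _ => nodup_blockList b, ?_⟩
  refine (Finset.sort_nodup B (· ≤ ·)).imp_of_mem fun {b c} hb hc hne z hz hz' => ?_
  rw [Finset.mem_sort] at hb hc
  exact hne (block_unique hB hb hc ((mem_blockList).1 hz).1 ((mem_blockList).1 hz').1)

lemma toFinset_flatMap_blockList (hB : IsBasis X B) :
    ((B.sort (· ≤ ·)).flatMap (blockList X B)).toFinset =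
      Finset.univ \ (B ∪ extActive X B) := by
  ext z
  simp only [List.mem_toFinset, List.mem_flatMap, Finset.mem_sort, Finset.mem_sdiff,
    Finset.mem_univ, true_and, Finset.mem_union, not_or]
  constructor
  · rintro ⟨b, hb, hz⟩
    rw [mem_blockList] at hz
    exact ⟨fun h => hz.2 (eq_of_mem_block_of_mem hB hb hz.1 h),
      ((mem_block_iff hB hb).1 hz.1).1⟩
  · rintro ⟨hzB, hz⟩
    obtain ⟨b, hb, hzb⟩ := exists_mem_block hB hz
    exact ⟨b, hb, (mem_blockList).2 ⟨hzb, fun h => hzB (h ▸ hb)⟩⟩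

lemma polyF_isHomogeneous (hB : IsBasis X B) :
    (polyF X B).IsHomogeneous (Finset.univ \ (B ∪ extActive X B)).card := by
  have := foldl_blockPoly_isHomogeneous (l := B.sort (· ≤ ·)) hB (by simp)
    (isHomogeneous_one (Fin r) ℝ)
  rwa [zero_add, ← List.toFinset_card_of_nodup (nodup_flatMap_blockList hB),
    toFinset_flatMap_blockList hB] at this

/-- The polynomials `Q_B` and `|det D| R^D` are dual to each other. -/
lemma pairing_polyQ_polyF {D : Finset (Fin N)} (hB : IsBasis X B) (hD : IsBasis X D) :
    pairing r (polyQ X B) (polyF X D) = if B = D then 1 else 0 := by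
  split_ifs with h
  · subst h
    have h1 := diffOp_flatMap_foldl_blockPoly (l := B.sort (· ≤ ·)) hB (by simp) 1
    rw [← List.prod_toFinset _ (nodup_flatMap_blockList hB),
      toFinset_flatMap_blockList hB] at h1
    rw [pairing_apply]
    erw [h1]
    simp
  -- Either the factors of `Q_B` include a whole block of `D`, or `D ∪ E(D)` is a proper subset of
  -- `B ∪ E(B)` and `Q_B` has too few factors.
  · by_cases hb : ∃ b ∈ D, block X D b ⊆ Finset.univ \ (B ∪ extActive X B)
    · obtain ⟨b, hb, hsub⟩ := hb
      rw [pairing_apply, polyQ, diffOp_prodPoly_polyF_of_block_subset hD hb hsub, map_zero]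
    · push Not at hb
      have hsub : D ∪ extActive X D ⊆ B ∪ extActive X B := by
        refine union_extActive_subset hD fun b hbD => ?_
        obtain ⟨z, hz, hz'⟩ := Finset.not_subset.1 (hb b hbD)
        exact ⟨z, hz, by rwa [Finset.mem_sdiff, not_and_not_right, imp_iff_right (Finset.mem_univ z)] at hz'⟩
      refine pairing_eq_zero_of_isHomogeneous (polyF_isHomogeneous hD) X _ ?_
      refine Finset.card_lt_card (Finset.ssubset_iff_subset_ne.2
        ⟨Finset.sdiff_subset_sdiff le_rfl hsub, fun heq => h ?_⟩)
      refine eq_of_union_extActive_eq hB hD ?_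
      rw [← Finset.compl_eq_univ_sdiff, ← Finset.compl_eq_univ_sdiff] at heq
      exact compl_injective heq

end polyF

/-! ### Forward exchange -/

section ForwardExchange

variable {X : Fin N → Fin r → ℝ} {𝔹' : Set (Finset (Fin N))}

/-- Under forward exchange, the elements of a basis may be replaced by arbitrary elements of
their blocks. -/
lemma ForwardExchange.image_mem (hF : ForwardExchange X 𝔹') {D : Finset (Fin N)}
    (hD : IsBasis X D) (hD' : D ∈ 𝔹') {z : Fin N → Fin N} (hz : ∀ b ∈ D, z b ∈ block X D b) :
    D.image z ∈ 𝔹' := by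
  -- The exchanges are made from left to right: before step `m`, the elements of `D` at positions
  -- below `m` have been replaced and the others are untouched.
  have key : ∀ m : ℕ, (D.filter fun c : Fin N => m ≤ (c : ℕ)) ∪
      (D.filter fun c : Fin N => (c : ℕ) < m).image z ∈ 𝔹' := by
    intro m
    induction m with
    | zero => simpa using hD'
    | succ m ih =>
      by_cases hm : ∃ b ∈ D, (b : ℕ) = m
      · obtain ⟨b, hb, rfl⟩ := hm
        set D' := (D.filter fun c : Fin N => (b : ℕ) ≤ (c : ℕ)) ∪
          (D.filter fun c : Fin N => (c : ℕ) < b).image z with hD'def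
        have hmem : ∀ c, c ∈ D' ↔ (c ∈ D ∧ b ≤ c) ∨ ∃ d ∈ D, d < b ∧ z d = c := by
          intro c
          simp [hD'def, and_assoc]
        have hzle : ∀ d ∈ D, z d ≤ d := fun d hd => le_of_mem_block hD hd (hz d hd)
        have hzb := (mem_block_iff hD hb).1 (hz b hb)
        have hltle : Submodule.span ℝ (X '' {c | c ∈ D' ∧ c < b}) ≤ flagLT X D b := by
          rw [Submodule.span_le]
          rintro _ ⟨c, ⟨hc, hcb⟩, rfl⟩
          rcases (hmem c).1 hc with ⟨_, hbc⟩ | ⟨d, hd, hdb, rfl⟩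
          · exact absurd hcb (not_lt.2 hbc)
          · rw [SetLike.mem_coe, mem_flagLT_iff hD]
            exact fun c hc hbc => (mem_flagLE_iff hD).1 ((mem_block_iff hD hd).1 (hz d hd)).2.1 c hc
              (hdb.trans_le hbc)
        have hnLT : X (z b) ∉ flagLT X D b := by
          rw [mem_flagLT_iff_of_mem hD hb hzb.2.1]; exact hzb.2.2
        have hbD' : b ∈ D' := (hmem b).2 (.inl ⟨hb, le_rfl⟩)
        have hle : flagLE X D b ≤ flagLE X D' b := by
          have hall : ∀ c ∈ D, c < b → X c ∈ flagLE X D' b := by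
            intro c hc hcb
            refine mem_of_mem_block_mem hD hz (b := c) (fun d hd hdc => ?_) c hc le_rfl
            exact Submodule.subset_span ⟨z d, ⟨(hmem _).2 (.inr ⟨d, hd, hdc.trans_lt hcb, rfl⟩),
              (hzle d hd).trans (hdc.trans hcb.le)⟩, rfl⟩
          rw [flagLE, Submodule.span_le]
          rintro _ ⟨c, ⟨hc, hcb⟩, rfl⟩
          rcases hcb.eq_or_lt with rfl | hcb
          · exact Submodule.subset_span ⟨c, ⟨hbD', le_rfl⟩, rfl⟩
          · exact hall c hc hcb
        -- External activity is excluded: either `z b = b` belongs to `D'`, or `z b < b` and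
        -- activity would put `X (z b)` into the span of the elements of `D'` before `b`, hence into
        -- `flagLT X D b`.
        have := hF D' ih b hbD' (z b) (hle hzb.2.1) (fun h => hnLT (hltle h)) (fun h => by
          rw [extActive, Finset.mem_filter] at h
          rcases (hzle b hb).eq_or_lt with heq | hlt
          · exact h.2.1 (by rwa [heq])
          · refine hnLT (hltle (Submodule.span_mono (Set.image_mono fun c hc => ?_) h.2.2))
            exact ⟨hc.1, hc.2.trans_lt hlt⟩)
        convert this using 1
        ext c
        simp only [Finset.mem_union, Finset.mem_filter, Finset.mem_image, Finset.mem_insert,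
          Finset.mem_erase, hmem]
        constructor
        · rintro (⟨hc, hbc⟩ | ⟨d, ⟨hd, hdb⟩, rfl⟩)
          · exact .inr ⟨by rintro rfl; omega, .inl ⟨hc, by rw [Fin.le_def]; omega⟩⟩
          · rcases (Nat.lt_succ_iff.1 hdb).eq_or_lt with heq | hlt
            · left; rw [Fin.ext heq]
            · exact .inr ⟨((hzle d hd).trans_lt hlt).ne, .inr ⟨d, hd, hlt, rfl⟩⟩
        · rintro (rfl | ⟨hne, ⟨hc, hbc⟩ | ⟨d, hd, hdb, rfl⟩⟩)
          · exact .inr ⟨b, ⟨hb, by omega⟩, rfl⟩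
          · exact .inl ⟨hc, lt_of_le_of_ne hbc (Ne.symm hne)⟩
          · exact .inr ⟨d, ⟨hd, by rw [Fin.lt_def] at hdb; omega⟩, rfl⟩
      · push Not at hm
        convert ih using 2
        · exact Finset.filter_congr fun c hc => by have := hm c hc; omega
        · congr 1
          exact Finset.filter_congr fun c hc => by have := hm c hc; omega
  have := key N
  rwa [Finset.filter_false_of_mem (fun c _ => by omega), Finset.empty_union,
    Finset.filter_true_of_mem (fun c _ => c.2)] at this

lemma mem_spaceD_of_diffOp_eq_zero {f : MvPolynomial (Fin r) ℝ}
    (h : ∀ C, IsCocircuit 𝔹' C → diffOp r (prodPoly X C) f = 0) : f ∈ spaceD X 𝔹' := by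
  intro q hq
  have : diffOp r q f = 0 := by
    induction hq using Submodule.span_induction with
    | zero => simp
    | add p q _ _ hp hq => rw [map_add, LinearMap.add_apply, hp, hq, add_zero]
    | smul a q _ hq => rw [smul_eq_mul, diffOp_mul, hq, map_zero]
    | mem q hq =>
      obtain ⟨C, hC, rfl⟩ := hq
      exact h C hC
  rw [pairing_apply, this, map_zero]

/-- If a cocircuit contained no block of `D`, elements of the blocks outside it would form a member
of `𝔹'` disjoint from it. -/
lemma polyF_mem_spaceD (hF : ForwardExchange X 𝔹') {D : Finset (Fin N)}
    (hD : IsBasis X D) (hD' : D ∈ 𝔹') : polyF X D ∈ spaceD X 𝔹' := by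
  refine mem_spaceD_of_diffOp_eq_zero fun C hC => ?_
  by_cases h : ∃ b ∈ D, block X D b ⊆ C
  · obtain ⟨b, hb, hsub⟩ := h
    exact diffOp_prodPoly_polyF_of_block_subset hD hb hsub
  · exfalso
    push Not at h
    have h' : ∀ b ∈ D, ∃ z ∈ block X D b, z ∉ C := fun b hb => Finset.not_subset.1 (h b hb)
    choose! z hz hzC using h'
    obtain ⟨c, hc⟩ := hC.prop _ (hF.image_mem hD hD' hz)
    rw [Finset.mem_inter, Finset.mem_image] at hc
    obtain ⟨hcC, b, hb, rfl⟩ := hc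
    exact hzC b hb hcC

/-- A set that meets all members of `𝔹'` contains a cocircuit, so `p_C` and all its multiples lie in
the ideal. Thus `p_C(∂) f` pairs to zero with every polynomial, and non-degeneracy applies. -/
lemma diffOp_eq_zero_of_mem_spaceD {f : MvPolynomial (Fin r) ℝ} (hf : f ∈ spaceD X 𝔹')
    {C : Finset (Fin N)} (hC : ∀ B ∈ 𝔹', (C ∩ B).Nonempty) : diffOp r (prodPoly X C) f = 0 := by
  obtain ⟨C', hC'C, hC'⟩ := exists_minimal_le_of_wellFoundedLT
    (fun D : Finset (Fin N) => ∀ B ∈ 𝔹', (D ∩ B).Nonempty) C hC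
  refine eq_zero_of_pairing_eq_zero fun q => ?_
  rw [← pairing_mul]
  refine hf _ (Ideal.mul_mem_left _ _ ?_)
  rw [prodPoly, ← Finset.prod_sdiff hC'C]
  exact Ideal.mul_mem_left _ _ (Ideal.subset_span ⟨C', hC', rfl⟩)

/-- The first `k` elements of `X` have been decided: those in `L` are contracted, the others deleted
or skipped as loops, and only the `B ∈ 𝔹'` whose part below `k` is `L` remain. The hypotheses on `f`
are the annihilation and orthogonality conditions of this minor. At the end, either `L ∈ 𝔹'` and `f`
is a constant with value `0`, or no basis remains and the empty set is admissible as `C`. -/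
lemma eq_zero_of_contraction (h𝔹' : ∀ B ∈ 𝔹', IsBasis X B) (hF : ForwardExchange X 𝔹') (n : ℕ) :
    ∀ (k : ℕ) (_ : k + n = N) (L : Finset (Fin N)) (_ : ∀ x ∈ L, (x : ℕ) < k)
      (f : MvPolynomial (Fin r) ℝ) (_ : ∀ x ∈ L, dirD (X x) f = 0)
      (_ : ∀ C : Finset (Fin N), (∀ x ∈ C, k ≤ (x : ℕ)) →
        (∀ B ∈ 𝔹', (B.filter fun c : Fin N => (c : ℕ) < k) = L → (C ∩ B).Nonempty) →
        diffOp r (prodPoly X C) f = 0)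
      (_ : ∀ B ∈ 𝔹', (B.filter fun c : Fin N => (c : ℕ) < k) = L →
        pairing r (prodPoly X (Finset.univ.filter fun x : Fin N =>
          k ≤ (x : ℕ) ∧ x ∉ B ∪ extActive X B)) f = 0), f = 0 := by
  induction n with
  | zero =>
    rintro k rfl L hL f h1 h2 h3
    have hfilter : ∀ B : Finset (Fin k), (B.filter fun c : Fin k => (c : ℕ) < k) = B :=
      fun B => Finset.filter_true_of_mem fun c _ => c.2
    by_cases hL' : L ∈ 𝔹'
    · have h4 : ∀ x, dirD x f = 0 := fun x =>
        dirD_eq_zero_of_mem_span (s := X '' L) (by rintro _ ⟨y, hy, rfl⟩; exact h1 y hy)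
          ((h𝔹' L hL').2 ▸ Submodule.mem_top)
      have h5 := h3 L hL' (hfilter L)
      rw [Finset.filter_false_of_mem (fun c _ => by omega), prodPoly, Finset.prod_empty,
        pairing_apply, diffOp_one] at h5
      rw [eq_C_of_dirD_eq_zero h4, h5, C_0]
    · have := h2 ∅ (by simp) fun B hB hBL => absurd (hBL.symm.trans (hfilter B) ▸ hB) hL'
      rwa [prodPoly, Finset.prod_empty, diffOp_one] at this
  | succ n ih =>
    intro k hk L hL f h1 h2 h3
    obtain ⟨x, hxk⟩ : ∃ x : Fin N, (x : ℕ) = k := ⟨⟨k, by omega⟩, rfl⟩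
    have hxL : x ∉ L := fun h => by have := hL x h; omega
    have hfilter : ∀ B : Finset (Fin N), (B.filter fun c : Fin N => (c : ℕ) < k + 1) =
        if x ∈ B then insert x (B.filter fun c : Fin N => (c : ℕ) < k)
        else B.filter fun c : Fin N => (c : ℕ) < k := by
      intro B
      ext c
      have hcx : c = x ↔ (c : ℕ) = k := by rw [Fin.ext_iff, hxk]
      split_ifs with hx
      · rw [Finset.mem_insert, Finset.mem_filter, Finset.mem_filter]
        constructor
        · rintro ⟨h, h'⟩
          rcases (Nat.lt_succ_iff.1 h').eq_or_lt with heq | hlt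
          · exact .inl (hcx.2 heq)
          · exact .inr ⟨h, hlt⟩
        · rintro (rfl | ⟨h, h'⟩)
          · exact ⟨hx, by omega⟩
          · exact ⟨h, by omega⟩
      · rw [Finset.mem_filter, Finset.mem_filter]
        refine and_congr_right fun h => ?_
        have : (c : ℕ) ≠ k := fun h' => hx (hcx.2 h' ▸ h)
        omega
    have hnotMem : ∀ B : Finset (Fin N), (B.filter fun c : Fin N => (c : ℕ) < k + 1) = L →
        x ∉ B ∧ (B.filter fun c : Fin N => (c : ℕ) < k) = L := by
      intro B hB
      have hx : x ∉ B := fun hx => hxL (hB ▸ Finset.mem_filter.2 ⟨hx, by omega⟩)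
      rw [hfilter, if_neg hx] at hB
      exact ⟨hx, hB⟩
    have hmem : ∀ B : Finset (Fin N),
        (B.filter fun c : Fin N => (c : ℕ) < k + 1) = insert x L →
        x ∈ B ∧ (B.filter fun c : Fin N => (c : ℕ) < k) = L := by
      intro B hB
      have hx : x ∈ B := by
        have : x ∈ B.filter fun c : Fin N => (c : ℕ) < k + 1 := hB ▸ Finset.mem_insert_self x L
        exact (Finset.mem_filter.1 this).1
      rw [hfilter, if_pos hx] at hB
      refine ⟨hx, ?_⟩
      have h := congrArg (fun s => Finset.erase s x) hB
      simpa [Finset.erase_insert hxL, Finset.erase_insert, hxk] using h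
    have hflag : ∀ B : Finset (Fin N), x ∉ B → (B.filter fun c : Fin N => (c : ℕ) < k) = L →
        flagLE X B x = Submodule.span ℝ (X '' (L : Set (Fin N))) := by
      intro B hx hB
      rw [flagLE, ← hB]
      congr 2
      ext c
      simp only [Set.mem_ofPred_eq, Finset.coe_filter]
      refine and_congr_right fun hc => ?_
      rw [Fin.le_def, hxk]
      have : (c : ℕ) ≠ k := fun h => hx (by rwa [← Fin.ext (h.trans hxk.symm)])
      omega
    have hset : ∀ B : Finset (Fin N), x ∈ B ∪ extActive X B →
        (Finset.univ.filter fun y : Fin N => k ≤ (y : ℕ) ∧ y ∉ B ∪ extActive X B) =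
        Finset.univ.filter fun y : Fin N => k + 1 ≤ (y : ℕ) ∧ y ∉ B ∪ extActive X B := by
      intro B hx
      refine Finset.filter_congr fun y _ => and_congr_left fun hy => ?_
      have : (y : ℕ) ≠ k := fun h => hy (by rwa [Fin.ext (h.trans hxk.symm)])
      omega
    -- In the span of `L`, the element `x` is a loop: it lies in no remaining basis and is
    -- externally active for each of them, so it may be skipped.
    by_cases hspan : X x ∈ Submodule.span ℝ (X '' (L : Set (Fin N)))
    · refine ih (k + 1) (by omega) L (fun y hy => (hL y hy).trans (Nat.lt_succ_self k)) f h1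
        (fun C hC hCB => h2 C (fun y hy => by have := hC y hy; omega) fun B hB hBL => ?_)
        (fun B hB hBL => ?_)
      · refine hCB B hB ?_
        have hx : x ∉ B := by
          intro hx
          have h4 : X x ∈ flagLT X B x := by
            refine Submodule.span_mono (Set.image_mono fun c hc => ?_) hspan
            rw [← hBL, Finset.mem_coe, Finset.mem_filter] at hc
            exact ⟨hc.1, by rw [Fin.lt_def, hxk]; exact hc.2⟩
          have := (mem_flagLT_iff (h𝔹' B hB)).1 h4 x hx le_rfl
          simp [coord_apply (h𝔹' B hB) hx hx] at this
        rwa [hfilter, if_neg hx]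
      · obtain ⟨hx, hBL'⟩ := hnotMem B hBL
        rw [← hset B (mem_union_extActive.2 (by rwa [hflag B hx hBL']))]
        exact h3 B hB hBL'
    -- Deletion: for bases avoiding `x`, the vector `x` is a factor of `Q_B`, so the conditions on
    -- `f` become conditions on its derivative along `x`.
    · have hd : dirD (X x) f = 0 := by
        refine ih (k + 1) (by omega) L (fun y hy => (hL y hy).trans (Nat.lt_succ_self k)) _
          (fun y hy => by rw [dirD_comm, h1 y hy, map_zero]) (fun C hC hCB => ?_)
          (fun B hB hBL => ?_)
        · rw [← diffOp_prodPoly_insert (fun h => by have := hC x h; omega)]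
          refine h2 _ (fun y hy => ?_) fun B hB hBL => ?_
          · rcases Finset.mem_insert.1 hy with rfl | hy
            · exact hxk.ge
            · have := hC y hy; omega
          · by_cases hx : x ∈ B
            · exact ⟨x, by simp [hx]⟩
            · refine (hCB B hB (by rwa [hfilter, if_neg hx])).mono ?_
              exact Finset.inter_subset_inter_right (Finset.subset_insert _ _)
        · obtain ⟨hx, hBL'⟩ := hnotMem B hBL
          have hxB : x ∉ B ∪ extActive X B := fun h => by
            rw [mem_union_extActive, hflag B hx hBL'] at h; exact hspan h
          have := h3 B hB hBL'
          have hins : (Finset.univ.filter fun y : Fin N => k ≤ (y : ℕ) ∧ y ∉ B ∪ extActive X B) =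
              insert x (Finset.univ.filter fun y : Fin N =>
                k + 1 ≤ (y : ℕ) ∧ y ∉ B ∪ extActive X B) := by
            ext y
            simp only [Finset.mem_insert, Finset.mem_filter, Finset.mem_univ, true_and]
            constructor
            · rintro ⟨h, h'⟩
              rcases h.eq_or_lt with heq | hlt
              · exact .inl (Fin.ext (heq.symm.trans hxk.symm))
              · exact .inr ⟨hlt, h'⟩
            · rintro (rfl | ⟨h, h'⟩)
              · exact ⟨hxk.ge, hxB⟩
              · exact ⟨by omega, h'⟩
          rwa [hins, pairing_apply, diffOp_prodPoly_insert (by simp [hxk]), ← pairing_apply] at this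
      -- Contraction: the vanishing derivative along `x` allows `x` to be added to `L`.
      refine ih (k + 1) (by omega) (insert x L) (fun y hy => ?_) f (fun y hy => ?_)
        (fun C hC hCB => h2 C (fun y hy => by have := hC y hy; omega) fun B hB hBL => ?_)
        (fun B hB hBL => ?_)
      · rcases Finset.mem_insert.1 hy with rfl | hy
        · omega
        · exact (hL y hy).trans (Nat.lt_succ_self k)
      · rcases Finset.mem_insert.1 hy with rfl | hy
        · exact hd
        · exact h1 y hy
      · by_cases hx : x ∈ B
        · exact hCB B hB (by rw [hfilter, if_pos hx, hBL])
        · have hxE : x ∉ extActive X B := fun h => by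
            have := mem_union_extActive.1 (Finset.mem_union_right B h)
            rw [hflag B hx hBL] at this; exact hspan this
          -- A remaining basis avoiding `x` is exchanged for one containing `x`, at the cost of a
          -- later element `b`. The set `C` meets the new basis, and not in `x`, hence it meets `B`.
          obtain ⟨b, hb, hxb⟩ := exists_mem_block (h𝔹' B hB) hxE
          have hlt : x < b := lt_of_le_of_ne (le_of_mem_block (h𝔹' B hB) hb hxb)
            fun h => hx (h ▸ hb)
          have hxb' := (Finset.mem_filter.1 hxb).2
          have hB' := hF B hB b hb x hxb'.1 hxb'.2 hxE
          obtain ⟨y, hy⟩ := hCB _ hB' (by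
            rw [hfilter, if_pos (Finset.mem_insert_self _ _), ← hBL]
            congr 1
            ext c
            simp only [Finset.mem_filter, Finset.mem_insert, Finset.mem_erase]
            rw [Fin.lt_def] at hlt
            constructor
            · rintro ⟨rfl | ⟨_, h⟩, h'⟩
              · omega
              · exact ⟨h, h'⟩
            · rintro ⟨h, h'⟩
              exact ⟨.inr ⟨by rintro rfl; omega, h⟩, h'⟩)
          rw [Finset.mem_inter, Finset.mem_insert, Finset.mem_erase] at hy
          obtain ⟨hyC, rfl | ⟨_, hyB⟩⟩ := hy
          · have := hC y hyC; omega
          · exact ⟨y, Finset.mem_inter.2 ⟨hyC, hyB⟩⟩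
      · obtain ⟨hx, hBL'⟩ := hmem B hBL
        rw [← hset B (Finset.mem_union_left _ hx)]
        exact h3 B hB hBL'

/-- An element of `D(X, 𝔹')` that is orthogonal to `P(X, 𝔹')` vanishes. -/
lemma eq_zero_of_mem_spaceD (h𝔹' : ∀ B ∈ 𝔹', IsBasis X B) (hF : ForwardExchange X 𝔹')
    {f : MvPolynomial (Fin r) ℝ} (hf : f ∈ spaceD X 𝔹')
    (h : ∀ B ∈ 𝔹', pairing r (polyQ X B) f = 0) : f = 0 := by
  refine eq_zero_of_contraction h𝔹' hF N 0 (zero_add N) ∅ (by simp) f (by simp)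
    (fun C _ hC => diffOp_eq_zero_of_mem_spaceD hf fun B hB => hC B hB (by simp))
    fun B hB _ => ?_
  have hset : (Finset.univ.filter fun x : Fin N => 0 ≤ (x : ℕ) ∧ x ∉ B ∪ extActive X B) =
      Finset.univ \ (B ∪ extActive X B) := by
    ext x
    simp
  rw [hset]
  exact h B hB

end ForwardExchange

/-! ### Bounded measurable functions with bounded support -/

/-- Bounded measurable functions that vanish outside of a bounded set. -/
def BddMeas {E : Type*} [NormedAddCommGroup E] [MeasurableSpace E] (f : E → ℝ) : Prop :=
  Measurable f ∧ ∃ M R : ℝ, ∀ u, |f u| ≤ M ∧ (R < ‖u‖ → f u = 0)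

section BddMeas

variable {E F : Type*} [NormedAddCommGroup E] [MeasurableSpace E] [NormedAddCommGroup F]
  [MeasurableSpace F]

lemma BddMeas.integrable [ProperSpace E] [OpensMeasurableSpace E] {f : E → ℝ} (hf : BddMeas f)
    (ν : Measure E) [IsFiniteMeasureOnCompacts ν] : Integrable f ν := by
  obtain ⟨hm, M, R, h⟩ := hf
  have h1 : IntegrableOn f (Metric.closedBall 0 R) ν :=
    Measure.integrableOn_of_bounded (isCompact_closedBall 0 R).measure_lt_top.ne
      hm.aestronglyMeasurable (M := M) (Filter.Eventually.of_forall fun u => (h u).1)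
  refine h1.integrable_of_forall_notMem_eq_zero fun u hu => (h u).2 ?_
  simpa using hu

lemma BddMeas.continuous_mul [ProperSpace E] [BorelSpace E] {f g : E → ℝ} (hf : BddMeas f)
    (hg : Continuous g) : BddMeas fun u => g u * f u := by
  obtain ⟨hm, M, R, h⟩ := hf
  obtain ⟨K, hK⟩ := (isCompact_closedBall (0 : E) R).exists_bound_of_continuousOn hg.continuousOn
  refine ⟨hg.measurable.mul hm, |K| * M, R, fun u => ⟨?_, fun hu => by simp [(h u).2 hu]⟩⟩
  have hM : 0 ≤ M := (abs_nonneg _).trans (h u).1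
  by_cases hu : ‖u‖ ≤ R
  · rw [abs_mul]
    exact mul_le_mul ((hK u (by simpa using hu)).trans (le_abs_self K)) (h u).1 (abs_nonneg _)
      (abs_nonneg _)
  · simp only [(h u).2 (not_le.1 hu), mul_zero, abs_zero]
    positivity

lemma BddMeas.const_mul {f : E → ℝ} (hf : BddMeas f) (c : ℝ) : BddMeas fun u => c * f u := by
  obtain ⟨hm, M, R, h⟩ := hf
  refine ⟨hm.const_mul c, |c| * M, R, fun u => ⟨?_, fun hu => by simp [(h u).2 hu]⟩⟩
  rw [abs_mul]
  exact mul_le_mul_of_nonneg_left (h u).1 (abs_nonneg _)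

lemma BddMeas.sub {f g : E → ℝ} (hf : BddMeas f) (hg : BddMeas g) :
    BddMeas fun u => f u - g u := by
  obtain ⟨hm, M, R, h⟩ := hf
  obtain ⟨hm', M', R', h'⟩ := hg
  refine ⟨hm.sub hm', M + M', max R R', fun u => ⟨(abs_sub _ _).trans (add_le_add (h u).1 (h' u).1),
    fun hu => ?_⟩⟩
  rw [max_lt_iff] at hu
  simp only [(h u).2 hu.1, (h' u).2 hu.2, sub_zero]

/-- The hypothesis `h` is properness of `ψ` on `s`. It keeps supports bounded although splines
integrate over unbounded cones. -/
lemma BddMeas.indicator_comp {f : E → ℝ} (hf : BddMeas f) {ψ : F → E} (hψ : Measurable ψ)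
    {s : Set F} (hs : MeasurableSet s)
    (h : ∀ R : ℝ, ∃ R' : ℝ, ∀ v ∈ s, ‖ψ v‖ ≤ R → ‖v‖ ≤ R') :
    BddMeas (s.indicator fun v => f (ψ v)) := by
  obtain ⟨hm, M, R, hf⟩ := hf
  obtain ⟨R', hR'⟩ := h R
  refine ⟨(hm.comp hψ).indicator hs, M, R', fun v => ?_⟩
  by_cases hv : v ∈ s
  · rw [Set.indicator_of_mem hv]
    exact ⟨(hf _).1, fun hlt => (hf _).2 (by
      by_contra hle
      exact absurd (hR' v hv (not_lt.1 hle)) (not_le.2 hlt))⟩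
  · rw [Set.indicator_of_notMem hv]
    exact ⟨by simpa using (abs_nonneg _).trans (hf (ψ v)).1, fun _ => rfl⟩

lemma BddMeas.indicator {f : E → ℝ} (hf : BddMeas f) {s : Set E} (hs : MeasurableSet s) :
    BddMeas (s.indicator f) :=
  hf.indicator_comp measurable_id hs fun R => ⟨R, fun _ _ h => h⟩

lemma BddMeas.comp_add_left [MeasurableAdd E] {f : E → ℝ} (hf : BddMeas f) (v : E) :
    BddMeas fun u => f (v + u) := by
  have := hf.indicator_comp (measurable_const_add v) MeasurableSet.univ
    fun R => ⟨R + ‖v‖, fun u _ h => by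
      have := norm_sub_le (v + u) v
      rw [add_sub_cancel_left] at this
      linarith⟩
  simpa using this

lemma BddMeas.integral_right [ProperSpace F] [OpensMeasurableSpace F] {k : E × F → ℝ}
    (hk : BddMeas k) (ν : Measure F) [IsFiniteMeasureOnCompacts ν] [SFinite ν] :
    BddMeas fun u => ∫ v, k (u, v) ∂ν := by
  obtain ⟨hm, M, R, h⟩ := hk
  refine ⟨hm.stronglyMeasurable.integral_prod_right'.measurable,
    M * ν.real (Metric.closedBall 0 R), R, fun u => ⟨?_, fun hu => ?_⟩⟩
  · simp only
    rw [← setIntegral_eq_integral_of_forall_compl_eq_zero (s := Metric.closedBall (0 : F) R)]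
    · exact norm_setIntegral_le_of_norm_le_const (f := fun v => k (u, v)) (isCompact_closedBall 0 R).measure_lt_top
        fun v _ => (h _).1
    · intro v hv
      refine (h _).2 ?_
      rw [mem_closedBall_zero_iff, not_le] at hv
      exact hv.trans_le (le_max_right _ _)
  · have : ∀ v, k (u, v) = 0 := fun v => (h _).2 (hu.trans_le (le_max_left _ _))
    simp [this]

end BddMeas

lemma continuous_eval_poly (F : MvPolynomial (Fin r) ℝ) : Continuous fun u => eval u F :=
  MvPolynomial.continuous_eval F

/-! ### Half-spaces of subspaces -/

/-- The half-space `t ≥ 0` of the subspace `S`. -/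
def halfSpace (S : Submodule ℝ (Fin r → ℝ)) (t : Module.Dual ℝ (Fin r → ℝ)) :
    Set (Fin r → ℝ) := {u | u ∈ S ∧ 0 ≤ t u}

lemma continuous_dual (t : Module.Dual ℝ (Fin r → ℝ)) : Continuous t :=
  LinearMap.continuous_of_finiteDimensional t

lemma measurableSet_submodule (S : Submodule ℝ (Fin r → ℝ)) :
    MeasurableSet (S : Set (Fin r → ℝ)) :=
  S.closed_of_finiteDimensional.measurableSet

lemma measurableSet_halfSpace (S : Submodule ℝ (Fin r → ℝ)) (t : Module.Dual ℝ (Fin r → ℝ)) :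
    MeasurableSet (halfSpace S t) :=
  (measurableSet_submodule S).inter ((continuous_dual t).measurable measurableSet_Ici)

lemma exists_dual_bound (t : Module.Dual ℝ (Fin r → ℝ)) :
    ∃ K : ℝ, 0 ≤ K ∧ ∀ u, t u ≤ K * ‖u‖ :=
  ⟨‖LinearMap.toContinuousLinearMap t‖, norm_nonneg _, fun u =>
    (le_abs_self _).trans ((LinearMap.toContinuousLinearMap t).le_opNorm u)⟩

/-- Functions that are bounded and measurable with bounded support on `A`. -/
def NiceOn (A : Set (Fin r → ℝ)) (g : (Fin r → ℝ) → ℝ) : Prop := BddMeas (A.indicator g)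

lemma NiceOn.mono {A A' : Set (Fin r → ℝ)} {g : (Fin r → ℝ) → ℝ} (hg : NiceOn A g)
    (hA' : MeasurableSet A') (h : A' ⊆ A) : NiceOn A' g := by
  have := BddMeas.indicator hg hA'
  rwa [Set.indicator_indicator, Set.inter_eq_left.2 h] at this

section ray

variable {S : Submodule ℝ (Fin r → ℝ)} {t : Module.Dual ℝ (Fin r → ℝ)} {y : Fin r → ℝ}

lemma add_smul_mem_halfSpace (hy : y ∈ S) (hty : 0 < t y) {u : Fin r → ℝ}
    (hu : u ∈ halfSpace S t) {l : ℝ} (hl : 0 ≤ l) : u + l • y ∈ halfSpace S t :=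
  ⟨S.add_mem hu.1 (S.smul_mem l hy), by
    rw [map_add, map_smul, smul_eq_mul]; exact add_nonneg hu.2 (mul_nonneg hl hty.le)⟩

/-- The integral kernel of `ray_integral`. -/
def rayKernel (S : Submodule ℝ (Fin r → ℝ)) (t : Module.Dual ℝ (Fin r → ℝ)) (y : Fin r → ℝ)
    (g : (Fin r → ℝ) → ℝ) : (Fin r → ℝ) × ℝ → ℝ :=
  {p : (Fin r → ℝ) × ℝ | p.1 ∈ halfSpace S t ∧ 0 ≤ p.2}.indicator
    fun p => (halfSpace S t).indicator g (p.1 + p.2 • y)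

/-- On the half-space `t u ≥ 0`, so `l * t y ≤ t (u + l • y) ≤ K * R` bounds `l`, and then `u = (u +
l • y) - l • y` is bounded as well. -/
lemma rayKernel_bddMeas (hty : 0 < t y) {g : (Fin r → ℝ) → ℝ}
    (hg : NiceOn (halfSpace S t) g) : BddMeas (rayKernel S t y g) := by
  refine BddMeas.indicator_comp hg (by fun_prop) ?_ fun R => ?_
  · exact (measurable_fst (measurableSet_halfSpace S t)).inter
      (measurable_snd measurableSet_Ici)
  · obtain ⟨K, hK, hKt⟩ := exists_dual_bound t
    refine ⟨max (R + K * R / t y * ‖y‖) (K * R / t y), ?_⟩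
    rintro ⟨u, l⟩ ⟨hu, hl⟩ hR
    simp only at hu hl hR
    have h1 : l ≤ K * R / t y := by
      rw [le_div_iff₀ hty]
      have h2 := (hKt (u + l • y)).trans (mul_le_mul_of_nonneg_left hR hK)
      rw [map_add, map_smul, smul_eq_mul] at h2
      linarith [hu.2]
    refine max_le_max ?_ (by rwa [Real.norm_of_nonneg hl])
    have h3 := norm_sub_le (u + l • y) (l • y)
    rw [add_sub_cancel_right, norm_smul, Real.norm_of_nonneg hl] at h3
    exact h3.trans (add_le_add hR (mul_le_mul_of_nonneg_right h1 (norm_nonneg _)))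

lemma indicator_ray_eq (hy : y ∈ S) (hty : 0 < t y) (g : (Fin r → ℝ) → ℝ) :
    ((halfSpace S t).indicator fun u => ∫ l in Set.Ici (0 : ℝ), g (u + l • y)) =
      fun u => ∫ l, rayKernel S t y g (u, l) := by
  ext u
  by_cases hu : u ∈ halfSpace S t
  · rw [Set.indicator_of_mem hu, ← integral_indicator measurableSet_Ici]
    refine integral_congr_ae (Filter.Eventually.of_forall fun l => ?_)
    by_cases hl : 0 ≤ l
    · have h1 : (u, l) ∈ {p : (Fin r → ℝ) × ℝ | p.1 ∈ halfSpace S t ∧ 0 ≤ p.2} := ⟨hu, hl⟩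
      simp only [rayKernel]
      rw [Set.indicator_of_mem h1, Set.indicator_of_mem (Set.mem_Ici.2 hl),
        Set.indicator_of_mem (add_smul_mem_halfSpace hy hty hu hl)]
    · have h1 : (u, l) ∉ {p : (Fin r → ℝ) × ℝ | p.1 ∈ halfSpace S t ∧ 0 ≤ p.2} := fun h => hl h.2
      simp only [rayKernel]
      rw [Set.indicator_of_notMem h1, Set.indicator_of_notMem (by simpa using hl)]
  · rw [Set.indicator_of_notMem hu]
    have : ∀ l, rayKernel S t y g (u, l) = 0 := fun l =>
      Set.indicator_of_notMem (fun h => hu h.1) _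
    simp [this]

lemma NiceOn.ray (hy : y ∈ S) (hty : 0 < t y) {g : (Fin r → ℝ) → ℝ}
    (hg : NiceOn (halfSpace S t) g) :
    NiceOn (halfSpace S t) fun u => ∫ l in Set.Ici (0 : ℝ), g (u + l • y) := by
  rw [NiceOn, indicator_ray_eq hy hty]
  exact (rayKernel_bddMeas hty hg).integral_right volume

/-- The ray from `u` backwards along `y` reaches the hyperplane `t = 0` at `l = t u / t y`, where
the antiderivative vanishes; the rest is the fundamental theorem of calculus. -/
lemma integral_eval_sub_smul (hty : 0 < t y) (F : MvPolynomial (Fin r) ℝ) (u : Fin r → ℝ) :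
    ∫ l in (0 : ℝ)..(t u / t y), eval (u - l • y) F = eval u (antideriv t y F) := by
  have h1 : ∀ l : ℝ, HasDerivAt (fun s : ℝ => -eval (u + s • (-y)) (antideriv t y F))
      (eval (u - l • y) F) l := fun l => by
    have := (hasDerivAt_eval u (-y) (antideriv t y F) l).neg
    rw [dirD_neg, dirD_antideriv hty.ne', map_neg, neg_neg, smul_neg, ← sub_eq_add_neg] at this
    exact this
  rw [intervalIntegral.integral_eq_sub_of_hasDerivAt (fun l _ => h1 l)]
  · rw [eval_antideriv hty.ne' F (u := u + (t u / t y) • -y)]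
    · simp
    · simp [hty.ne']
  · refine Continuous.intervalIntegrable ?_ _ _
    exact (continuous_eval_poly F).comp (by fun_prop)

/-- Convolution with a ray acts on polynomial densities by antidifferentiation. -/
lemma ray_integral (hy : y ∈ S) (hty : 0 < t y) {g : (Fin r → ℝ) → ℝ}
    (hg : NiceOn (halfSpace S t) g) (μ : Measure (Fin r → ℝ)) [IsLocallyFiniteMeasure μ]
    (hμ : ∀ v ∈ S, MeasurePreserving (· + v) μ μ) (F : MvPolynomial (Fin r) ℝ) :
    ∫ u in halfSpace S t, eval u F * (∫ l in Set.Ici (0 : ℝ), g (u + l • y)) ∂μ =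
      ∫ u in halfSpace S t, eval u (antideriv t y F) * g u ∂μ := by
  have hA := measurableSet_halfSpace S t
  have hk := rayKernel_bddMeas hty hg
  have hFk : BddMeas fun p : (Fin r → ℝ) × ℝ => eval p.1 F * rayKernel S t y g p :=
    hk.continuous_mul ((continuous_eval_poly F).comp continuous_fst)
  have hshear : BddMeas fun p : (Fin r → ℝ) × ℝ =>
      eval (p.1 + (-p.2) • y) F * rayKernel S t y g (p.1 + (-p.2) • y, p.2) := by
    have := hFk.indicator_comp (ψ := fun p : (Fin r → ℝ) × ℝ => (p.1 + (-p.2) • y, p.2))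
      (by fun_prop) MeasurableSet.univ fun R => ⟨max (R + R * ‖y‖) R, ?_⟩
    · simpa using this
    · rintro ⟨u, l⟩ - h
      rw [Prod.norm_mk, max_le_iff] at h
      refine max_le_max ?_ h.2
      have h3 := norm_sub_le (u + -l • y) (-l • y)
      rw [add_sub_cancel_right, norm_smul, norm_neg] at h3
      exact h3.trans (add_le_add h.1 (mul_le_mul_of_nonneg_right h.2 (norm_nonneg _)))
  -- Fubini, the translation `u ↦ u - l • y` for fixed `l`, and Fubini back. The conditions `l ≥ 0`
  -- and `t (u - l • y) ≥ 0` then confine `l` to `[0, t u / t y]`.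
  calc ∫ u in halfSpace S t, eval u F * (∫ l in Set.Ici (0 : ℝ), g (u + l • y)) ∂μ
      = ∫ u, (∫ l, eval u F * rayKernel S t y g (u, l)) ∂μ := by
        rw [← integral_indicator hA]
        refine integral_congr_ae (Filter.Eventually.of_forall fun u => ?_)
        simp only
        rw [Set.indicator_mul_right, indicator_ray_eq hy hty, integral_const_mul]
    _ = ∫ l, ∫ u, eval u F * rayKernel S t y g (u, l) ∂μ :=
        integral_integral_swap (hFk.integrable (μ.prod volume))
    _ = ∫ l : ℝ, ∫ u, eval (u + (-l) • y) F * rayKernel S t y g (u + (-l) • y, l) ∂μ := by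
        refine integral_congr_ae (Filter.Eventually.of_forall fun l => ?_)
        exact ((hμ _ (S.smul_mem (-l) hy)).integral_comp (measurableEmbedding_addRight _)
          (fun u => eval u F * rayKernel S t y g (u, l))).symm
    _ = ∫ u, (∫ l : ℝ, eval (u + (-l) • y) F * rayKernel S t y g (u + (-l) • y, l)) ∂μ :=
        (integral_integral_swap (hshear.integrable (μ.prod volume))).symm
    _ = ∫ u in halfSpace S t, eval u (antideriv t y F) * g u ∂μ := by
        rw [← integral_indicator hA]
        refine integral_congr_ae (Filter.Eventually.of_forall fun u => ?_)
        simp only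
        by_cases hu : u ∈ halfSpace S t
        · rw [Set.indicator_of_mem hu, ← integral_eval_sub_smul hty,
            intervalIntegral.integral_of_le (div_nonneg hu.2 hty.le), ← integral_Icc_eq_integral_Ioc,
            ← integral_mul_const, ← integral_indicator measurableSet_Icc]
          refine integral_congr_ae (Filter.Eventually.of_forall fun l => ?_)
          simp only [rayKernel]
          have hmem : (u + -l • y, l) ∈ {p : (Fin r → ℝ) × ℝ | p.1 ∈ halfSpace S t ∧ 0 ≤ p.2} ↔
              l ∈ Set.Icc 0 (t u / t y) := by
            have h1 : u + -l • y ∈ S := S.add_mem hu.1 (S.smul_mem _ hy)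
            simp only [Set.mem_ofPred_eq, halfSpace, h1, true_and, map_add, map_smul, smul_eq_mul,
              Set.mem_Icc, le_div_iff₀ hty]
            constructor <;> rintro ⟨h, h'⟩ <;> constructor <;> linarith
          by_cases hl : l ∈ Set.Icc 0 (t u / t y)
          · rw [Set.indicator_of_mem hl, Set.indicator_of_mem (hmem.2 hl)]
            simp [hu, sub_eq_add_neg]
          · rw [Set.indicator_of_notMem hl, Set.indicator_of_notMem (mt hmem.1 hl), mul_zero]
        · rw [Set.indicator_of_notMem hu]
          have : ∀ l : ℝ, rayKernel S t y g (u + -l • y, l) = 0 := fun l => by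
            simp [rayKernel, Set.indicator_apply, hu]
          simp only [this, mul_zero, integral_zero]

end ray

/-! ### Iterated ray integrals -/

/-- The iterated integral along the rays spanned by the vectors of a list. -/
def rays : List (Fin r → ℝ) → Functional r
  | [] => fun h => h 0
  | y :: L => fun h => ∫ l in Set.Ici (0 : ℝ), rays L fun v => h (l • y + v)

lemma rays_append (L L' : List (Fin r → ℝ)) (h : (Fin r → ℝ) → ℝ) :
    rays (L ++ L') h = rays L fun ξ => rays L' fun v => h (ξ + v) := by
  induction L generalizing h with
  | nil => simp [rays]
  | cons y L ih => simp only [List.cons_append, rays, ih, add_assoc]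

section rays

variable {S : Submodule ℝ (Fin r → ℝ)} {t : Module.Dual ℝ (Fin r → ℝ)}

lemma rays_cons_add (y : Fin r → ℝ) (L : List (Fin r → ℝ)) (g : (Fin r → ℝ) → ℝ)
    (u : Fin r → ℝ) :
    (rays (y :: L) fun v => g (u + v)) =
      ∫ l in Set.Ici (0 : ℝ), rays L fun v => g (u + l • y + v) := by
  simp only [rays, add_assoc]

lemma NiceOn.rays {L : List (Fin r → ℝ)} (hL : ∀ y ∈ L, y ∈ S ∧ 0 < t y)
    {g : (Fin r → ℝ) → ℝ} (hg : NiceOn (halfSpace S t) g) :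
    NiceOn (halfSpace S t) fun u => ZonotopalSpaces.rays L fun v => g (u + v) := by
  induction L with
  | nil => simpa [ZonotopalSpaces.rays] using hg
  | cons y L ih =>
    simp only [rays_cons_add]
    exact (ih fun z hz => hL z (.tail _ hz)).ray (hL y (.head _)).1 (hL y (.head _)).2

lemma rays_integral {L : List (Fin r → ℝ)} (hL : ∀ y ∈ L, y ∈ S ∧ 0 < t y)
    {g : (Fin r → ℝ) → ℝ} (hg : NiceOn (halfSpace S t) g) (μ : Measure (Fin r → ℝ))
    [IsLocallyFiniteMeasure μ] (hμ : ∀ v ∈ S, MeasurePreserving (· + v) μ μ)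
    (F : MvPolynomial (Fin r) ℝ) :
    ∫ u in halfSpace S t, eval u F * (rays L fun v => g (u + v)) ∂μ =
      ∫ u in halfSpace S t, eval u (antiderivs t L F) * g u ∂μ := by
  induction L generalizing F with
  | nil => simp [rays]
  | cons y L ih =>
    have hL' : ∀ z ∈ L, z ∈ S ∧ 0 < t z := fun z hz => hL z (.tail _ hz)
    simp only [rays_cons_add]
    rw [ray_integral (hL y (.head _)).1 (hL y (.head _)).2 (hg.rays hL') μ hμ, ih hL']
    rfl

/-- Rays that start in the half-space stay in it, so `g` may be cut off outside. -/
lemma rays_congr {L : List (Fin r → ℝ)} (hL : ∀ y ∈ L, y ∈ S ∧ 0 < t y)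
    {g g' : (Fin r → ℝ) → ℝ} (hg : Set.EqOn g g' (halfSpace S t)) {u : Fin r → ℝ}
    (hu : u ∈ halfSpace S t) : (rays L fun v => g (u + v)) = rays L fun v => g' (u + v) := by
  induction L generalizing u with
  | nil => simpa [rays] using hg hu
  | cons y L ih =>
    rw [rays_cons_add, rays_cons_add]
    refine setIntegral_congr_fun measurableSet_Ici fun l hl => ?_
    exact ih (fun z hz => hL z (.tail _ hz))
      (add_smul_mem_halfSpace (hL y (.head _)).1 (hL y (.head _)).2 hu hl)

lemma measurableSet_orthant (ι : Type) [Fintype ι] :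
    MeasurableSet {l : ι → ℝ | ∀ i, 0 ≤ l i} := by
  have : {l : ι → ℝ | ∀ i, 0 ≤ l i} = ⋂ i, (fun l => l i) ⁻¹' Set.Ici 0 := by ext; simp
  rw [this]
  exact MeasurableSet.iInter fun i => measurable_pi_apply i measurableSet_Ici

lemma spline_congr {ι : Type} [Fintype ι] (y : ι → Fin r → ℝ) {φ ψ : (Fin r → ℝ) → ℝ}
    (h : ∀ l : ι → ℝ, (∀ i, 0 ≤ l i) → φ (∑ i, l i • y i) = ψ (∑ i, l i • y i)) :
    spline y φ = spline y ψ :=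
  setIntegral_congr_fun (measurableSet_orthant ι) fun l hl => h l hl

/-- All terms `l i * t (y i)` are nonnegative, so a bound for their sum bounds each `l i`. -/
lemma orthant_bddMeas {ι : Type} [Fintype ι] {y : ι → Fin r → ℝ} (hy : ∀ i, 0 < t (y i))
    {h : (Fin r → ℝ) → ℝ} (hh : BddMeas h) :
    BddMeas ({l : ι → ℝ | ∀ i, 0 ≤ l i}.indicator fun l => h (∑ i, l i • y i)) := by
  refine hh.indicator_comp (by fun_prop) (measurableSet_orthant ι) fun R => ?_
  obtain ⟨K, hK, hKt⟩ := exists_dual_bound t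
  refine ⟨∑ i, |K * R / t (y i)|, fun l hl hR => ?_⟩
  rw [pi_norm_le_iff_of_nonneg (Finset.sum_nonneg fun i _ => abs_nonneg _)]
  intro i
  refine le_trans ?_ (Finset.single_le_sum (f := fun i => |K * R / t (y i)|)
    (fun i _ => abs_nonneg _) (Finset.mem_univ i))
  refine le_trans ?_ (le_abs_self _)
  rw [Real.norm_of_nonneg (hl i), le_div_iff₀ (hy i)]
  refine le_trans ?_ ((hKt _).trans (mul_le_mul_of_nonneg_left hR hK))
  rw [map_sum]
  simp only [map_smul, smul_eq_mul]
  exact Finset.single_le_sum (f := fun i => l i * t (y i))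
    (fun i _ => mul_nonneg (hl i) (hy i).le) (Finset.mem_univ i)

lemma spline_fin_eq_rays {n : ℕ} {y : Fin n → Fin r → ℝ} (hy : ∀ i, 0 < t (y i))
    {h : (Fin r → ℝ) → ℝ} (hh : BddMeas h) : spline y h = rays (List.ofFn y) h := by
  induction n generalizing h with
  | zero =>
    simp [spline, rays, integral_unique, Measure.real, volume_pi]
  | succ n ih =>
    have hmp := (volume_preserving_piFinSuccAbove (fun _ : Fin (n + 1) => ℝ) 0).symm
    have hint := (orthant_bddMeas hy hh).integrable volume
    rw [spline, ← integral_indicator (measurableSet_orthant _),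
      ← hmp.integral_comp (MeasurableEquiv.measurableEmbedding _), Measure.volume_eq_prod,
      integral_prod]
    · rw [List.ofFn_succ, rays]
      simp only
      rw [← integral_indicator measurableSet_Ici]
      refine integral_congr_ae (Filter.Eventually.of_forall fun a => ?_)
      simp only
      by_cases ha : 0 ≤ a
      · rw [Set.indicator_of_mem (Set.mem_Ici.2 ha),
          ← ih (fun i => hy i.succ) (hh.comp_add_left (a • y 0)), spline,
          ← integral_indicator (measurableSet_orthant _)]
        refine integral_congr_ae (Filter.Eventually.of_forall fun l => ?_)
        simp only [Set.indicator_apply, MeasurableEquiv.piFinSuccAbove_symm_apply, Set.mem_ofPred_eq,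
          Fin.forall_fin_succ, Fin.sum_univ_succ]
        simp [ha]
      · rw [Set.indicator_of_notMem (by simpa using ha)]
        refine integral_eq_zero_of_ae (Filter.Eventually.of_forall fun l => ?_)
        refine Set.indicator_of_notMem (fun h => ha ?_) _
        simpa using h 0
    · exact (hmp.integrable_comp_emb (MeasurableEquiv.measurableEmbedding _)).2 hint

lemma spline_comp_equiv {ι ι' : Type} [Fintype ι] [Fintype ι'] (e : ι' ≃ ι) (y : ι → Fin r → ℝ)
    (h : (Fin r → ℝ) → ℝ) : spline (fun i => y (e i)) h = spline y h := by
  have hmp := volume_measurePreserving_piCongrLeft (fun _ : ι => ℝ) e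
  rw [spline, spline, ← hmp.setIntegral_preimage_emb (MeasurableEquiv.measurableEmbedding _)]
  have h1 : ∀ (l : ι' → ℝ) i, MeasurableEquiv.piCongrLeft (fun _ : ι => ℝ) e l (e i) = l i :=
    fun l i => Equiv.piCongrLeft_apply_apply (fun _ => ℝ) e l i
  congr 1
  · congr 1
    ext l
    simp only [Set.mem_preimage, Set.mem_ofPred_eq]
    rw [← e.forall_congr_right]
    simp [h1]
  · ext l
    rw [← e.sum_comp]
    simp [h1]

/-- The enumeration is free, so that later the ray of `b` itself can be put first. -/
lemma spline_finset_eq_rays {v : Fin N → Fin r → ℝ} {Y : Finset (Fin N)} {l : List (Fin N)}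
    (hl : l.Nodup) (hlY : ∀ i, i ∈ l ↔ i ∈ Y) (hY : ∀ i ∈ Y, 0 < t (v i))
    {h : (Fin r → ℝ) → ℝ} (hh : BddMeas h) :
    spline (fun i : Y => v i) h = rays (l.map v) h := by
  let e : Fin l.length ≃ Y := (hl.getEquiv l).trans (Equiv.subtypeEquivRight hlY)
  rw [← spline_comp_equiv e, spline_fin_eq_rays (t := t) (fun i => hY _ (e i).2) hh]
  congr 1
  refine List.ext_getElem (by simp) fun i h1 h2 => ?_
  simp [e]

lemma spline_finset_add_eq_rays {v : Fin N → Fin r → ℝ} {Y : Finset (Fin N)} {l : List (Fin N)}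
    (hl : l.Nodup) (hlY : ∀ i, i ∈ l ↔ i ∈ Y) (hY : ∀ i ∈ Y, v i ∈ S ∧ 0 < t (v i))
    {g : (Fin r → ℝ) → ℝ} (hg : NiceOn (halfSpace S t) g) {u : Fin r → ℝ}
    (hu : u ∈ halfSpace S t) :
    (spline (fun i : Y => v i) fun ξ => g (u + ξ)) = rays (l.map v) fun ξ => g (u + ξ) := by
  have heq : Set.EqOn g ((halfSpace S t).indicator g) (halfSpace S t) :=
    fun w hw => (Set.indicator_of_mem hw g).symm
  have hL : ∀ y ∈ l.map v, y ∈ S ∧ 0 < t y := by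
    intro y hy
    obtain ⟨i, hi, rfl⟩ := List.mem_map.1 hy
    exact hY i ((hlY i).1 hi)
  rw [rays_congr hL heq hu, ← spline_finset_eq_rays (t := t) hl hlY (fun i hi => (hY i hi).2)
    (hg.comp_add_left u)]
  refine spline_congr _ fun c hc => heq ⟨S.add_mem hu.1 (S.sum_mem fun i _ =>
    S.smul_mem _ (hY i i.2).1), ?_⟩
  rw [map_add, map_sum]
  refine add_nonneg hu.2 (Finset.sum_nonneg fun i _ => ?_)
  rw [map_smul, smul_eq_mul]
  exact mul_nonneg (hc i) (hY i i.2).2.le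

lemma convolve_spline_eq_rays {v w : Fin N → Fin r → ℝ} {Y Y' : Finset (Fin N)}
    {l l' : List (Fin N)} (hl : l.Nodup) (hlY : ∀ i, i ∈ l ↔ i ∈ Y) (hl' : l'.Nodup)
    (hlY' : ∀ i, i ∈ l' ↔ i ∈ Y') (hY : ∀ i ∈ Y, v i ∈ S ∧ 0 < t (v i))
    (hY' : ∀ i ∈ Y', w i ∈ S ∧ 0 < t (w i))
    {g : (Fin r → ℝ) → ℝ} (hg : NiceOn (halfSpace S t) g) {u : Fin r → ℝ}
    (hu : u ∈ halfSpace S t) :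
    convolve (spline fun i : Y => v i) (spline fun i : Y' => w i) (fun ξ => g (u + ξ)) =
      rays (l.map v ++ l'.map w) fun ξ => g (u + ξ) := by
  have hL' : ∀ y ∈ l'.map w, y ∈ S ∧ 0 < t y := by
    intro y hy
    obtain ⟨i, hi, rfl⟩ := List.mem_map.1 hy
    exact hY' i ((hlY' i).1 hi)
  rw [rays_append, convolve]
  simp only [← add_assoc]
  rw [← spline_finset_add_eq_rays hl hlY hY (hg.rays hL') hu]
  refine spline_congr _ fun c hc => ?_
  refine spline_finset_add_eq_rays hl' hlY' hY' hg ⟨S.add_mem hu.1 (S.sum_mem fun i _ =>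
    S.smul_mem _ (hY i i.2).1), ?_⟩
  rw [map_add, map_sum]
  refine add_nonneg hu.2 (Finset.sum_nonneg fun i _ => ?_)
  rw [map_smul, smul_eq_mul]
  exact mul_nonneg (hc i) (hY i i.2).2.le

end rays

/-! ### Lebesgue measures on the flag of a basis -/

/-- The convolution of `μ` with the Lebesgue measure of the line `ℝ b`. -/
def lineConv (μ : Measure (Fin r → ℝ)) (b : Fin r → ℝ) : Measure (Fin r → ℝ) :=
  (μ.prod volume).map fun p : (Fin r → ℝ) × ℝ => p.1 + p.2 • b

/-- `μ` behaves like a Lebesgue measure on the subspace `S`. -/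
structure IsLebesgueOn (S : Submodule ℝ (Fin r → ℝ)) (μ : Measure (Fin r → ℝ)) : Prop where
  locallyFinite : IsLocallyFiniteMeasure μ
  invariant : ∀ v ∈ S, MeasurePreserving (· + v) μ μ
  ae_mem : ∀ᵐ u ∂μ, u ∈ S

section lineConv

variable {S S' : Submodule ℝ (Fin r → ℝ)} {t : Module.Dual ℝ (Fin r → ℝ)} {b : Fin r → ℝ}
  {μ : Measure (Fin r → ℝ)}

lemma measurable_lineConv (b : Fin r → ℝ) :
    Measurable fun p : (Fin r → ℝ) × ℝ => p.1 + p.2 • b := by fun_prop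

/-- This lets the second term of a factor be treated as the first one, with `-b` and `-t` in place
of `b` and `t`. -/
lemma lineConv_neg [SFinite μ] (b : Fin r → ℝ) : lineConv μ (-b) = lineConv μ b := by
  have h : MeasurePreserving (fun p : (Fin r → ℝ) × ℝ => (p.1, -p.2)) (μ.prod volume)
      (μ.prod volume) :=
    (MeasurePreserving.id μ).prod (Measure.measurePreserving_neg volume)
  rw [lineConv, lineConv]
  conv_rhs => rw [← h.map_eq]
  rw [Measure.map_map (measurable_lineConv b) h.measurable]
  congr 1
  ext p
  simp

lemma isLebesgueOn_dirac : IsLebesgueOn (⊥ : Submodule ℝ (Fin r → ℝ)) (Measure.dirac 0) where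
  locallyFinite := inferInstance
  invariant v hv := by
    rw [Submodule.mem_bot] at hv
    subst hv
    simpa using! MeasurePreserving.id (Measure.dirac (0 : Fin r → ℝ))
  ae_mem := by
    exact (ae_dirac_iff (p := (· ∈ (⊥ : Submodule ℝ (Fin r → ℝ))))
      (measurableSet_submodule ⊥)).2 (Submodule.zero_mem _)

lemma IsLebesgueOn.ae_fst_mem (h : IsLebesgueOn S μ) :
    ∀ᵐ p : (Fin r → ℝ) × ℝ ∂μ.prod volume, p.1 ∈ S :=
  have := h.locallyFinite
  Measure.quasiMeasurePreserving_fst.ae h.ae_mem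

/-- The map `(s, l) ↦ s + l • b` identifies `S × ℝ` with `S'`, and `t` reads off `l`. In particular
a bound for `s + l • b` bounds `l` and then `s`. -/
lemma IsLebesgueOn.lineConv (h : IsLebesgueOn S μ) (hS : ∀ s ∈ S, t s = 0) (ht : t b = 1)
    (hS' : ∀ u, u ∈ S' ↔ u - t u • b ∈ S) : IsLebesgueOn S' (lineConv μ b) where
  locallyFinite := by
    have := h.locallyFinite
    refine ⟨fun x => ⟨Metric.ball x 1, Metric.ball_mem_nhds x one_pos, ?_⟩⟩
    obtain ⟨K, hK⟩ := (isCompact_closedBall x 1).exists_bound_of_continuousOn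
      (continuous_dual t).continuousOn
    rw [ZonotopalSpaces.lineConv, Measure.map_apply (measurable_lineConv b) Metric.isOpen_ball.measurableSet]
    refine lt_of_le_of_lt (measure_mono_ae (t := Metric.closedBall 0
      (max (‖x‖ + 1 + K * ‖b‖) K)) ?_) (isCompact_closedBall _ _).measure_lt_top
    filter_upwards [h.ae_fst_mem] with p hp hpx
    have hpx' : p.1 + p.2 • b ∈ Metric.closedBall x 1 := Metric.ball_subset_closedBall hpx
    have h1 := hK _ hpx'
    rw [map_add, hS _ hp, map_smul, ht, zero_add, smul_eq_mul, mul_one] at h1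
    rw [Metric.mem_closedBall, dist_eq_norm] at hpx'
    change p ∈ Metric.closedBall 0 _
    rw [mem_closedBall_zero_iff, Prod.norm_def]
    refine max_le_max ?_ h1
    calc ‖p.1‖ = ‖(p.1 + p.2 • b - x) + x - p.2 • b‖ := by congr 1; abel
      _ ≤ ‖p.1 + p.2 • b - x‖ + ‖x‖ + ‖p.2 • b‖ :=
        (norm_sub_le _ _).trans (add_le_add (norm_add_le _ _) le_rfl)
      _ ≤ 1 + ‖x‖ + K * ‖b‖ := by
        rw [norm_smul]
        exact add_le_add (add_le_add hpx' le_rfl) (mul_le_mul_of_nonneg_right h1 (norm_nonneg _))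
      _ = ‖x‖ + 1 + K * ‖b‖ := by ring
  invariant v hv := by
    have := h.locallyFinite
    have h1 : MeasurePreserving (Prod.map (· + (v - t v • b)) (· + t v)) (μ.prod volume)
        (μ.prod (volume : Measure ℝ)) :=
      (h.invariant _ ((hS' v).1 hv)).prod (measurePreserving_add_right volume (t v))
    refine ⟨measurable_add_const v, ?_⟩
    rw [ZonotopalSpaces.lineConv, Measure.map_map (measurable_add_const v) (measurable_lineConv b)]
    conv_rhs => rw [← h1.map_eq]
    rw [Measure.map_map (measurable_lineConv b) h1.measurable]
    congr 1
    ext p i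
    simp
    ring
  ae_mem := by
    have := h.locallyFinite
    refine (ae_map_iff (p := (· ∈ S')) (measurable_lineConv b).aemeasurable
      (measurableSet_submodule S')).2 ?_
    filter_upwards [h.ae_fst_mem] with p hp
    rw [hS', map_add, map_smul, hS _ hp, ht]
    simpa using hp

/-- This makes the overlap of the half-spaces `t ≥ 0` and `t ≤ 0` negligible. -/
lemma IsLebesgueOn.ae_ne_zero (h : IsLebesgueOn S μ) (hS : ∀ s ∈ S, t s = 0) (ht : t b = 1) :
    ∀ᵐ u ∂ZonotopalSpaces.lineConv μ b, t u ≠ 0 := by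
  have := h.locallyFinite
  have hm : MeasurableSet {u | t u ≠ 0} :=
    (continuous_dual t).measurable (measurableSet_singleton (0 : ℝ)).compl
  rw [ZonotopalSpaces.lineConv, ae_map_iff (measurable_lineConv b).aemeasurable hm]
  have h2 : ∀ᵐ p : (Fin r → ℝ) × ℝ ∂μ.prod volume, p.2 ≠ 0 :=
    Measure.quasiMeasurePreserving_snd.ae (Measure.ae_ne volume 0)
  filter_upwards [h.ae_fst_mem, h2] with p hp hp2
  rw [map_add, map_smul, hS _ hp, ht]
  simpa using hp2

/-- One half of the action of a factor `Rᵢ` on polynomial densities. -/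
lemma integral_rays_cons (h : IsLebesgueOn S μ) (hS : ∀ s ∈ S, t s = 0) (ht : t b = 1)
    (hS' : ∀ u, u ∈ S' ↔ u - t u • b ∈ S) {L : List (Fin r → ℝ)}
    (hL : ∀ y ∈ L, y ∈ S' ∧ 0 < t y) {g : (Fin r → ℝ) → ℝ} (hg : NiceOn (halfSpace S' t) g)
    {p : MvPolynomial (Fin r) ℝ} (hp : dirD b p = 0) :
    ∫ s, eval s p * (rays (b :: L) fun v => g (s + v)) ∂μ =
      ∫ u in halfSpace S' t, eval u (antiderivs t L p) * g u ∂ZonotopalSpaces.lineConv μ b := by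
  have := h.locallyFinite
  have h' := h.lineConv hS ht hS'
  have := h'.locallyFinite
  have hA := measurableSet_halfSpace S' t
  rw [← rays_integral hL hg _ h'.invariant, ← integral_indicator hA]
  set g₁ : (Fin r → ℝ) → ℝ := fun u => rays L fun v => g (u + v)
  have hg₁ : NiceOn (halfSpace S' t) g₁ := hg.rays hL
  have hpg : BddMeas fun u => eval u p * (halfSpace S' t).indicator g₁ u :=
    BddMeas.continuous_mul hg₁ (continuous_eval_poly p)
  have h1 : ((halfSpace S' t).indicator fun u => eval u p * g₁ u) =
      fun u => eval u p * (halfSpace S' t).indicator g₁ u := by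
    ext u; rw [Set.indicator_mul_right]
  rw [h1]
  have hint := hpg.integrable (ZonotopalSpaces.lineConv μ b)
  rw [ZonotopalSpaces.lineConv] at hint ⊢
  rw [integral_map (measurable_lineConv b).aemeasurable hpg.1.aestronglyMeasurable, integral_prod]
  · refine integral_congr_ae ?_
    filter_upwards [h.ae_mem] with s hs
    rw [rays_cons_add, ← integral_const_mul, ← integral_indicator measurableSet_Ici]
    refine integral_congr_ae (Filter.Eventually.of_forall fun l => ?_)
    simp only
    -- The density `p` is constant along `b`, so sweeping it along the ray of `b` extends it
    -- unchanged to the half-space.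
    rw [eval_add_smul_of_dirD_eq_zero hp]
    have hmem : s + l • b ∈ halfSpace S' t ↔ l ∈ Set.Ici 0 := by
      have h2 : t (s + l • b) = l := by rw [map_add, map_smul, hS _ hs, ht]; simp
      have h3 : s + l • b ∈ S' := by rw [hS', h2]; simpa using hs
      simp only [halfSpace, Set.mem_ofPred_eq, h2, h3, true_and, Set.mem_Ici]
    by_cases hl : l ∈ Set.Ici (0 : ℝ)
    · rw [Set.indicator_of_mem hl, Set.indicator_of_mem (hmem.2 hl)]
    · rw [Set.indicator_of_notMem hl, Set.indicator_of_notMem (mt hmem.1 hl), mul_zero]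
  · exact (integrable_map_measure hpg.1.aestronglyMeasurable
      (measurable_lineConv b).aemeasurable).1 hint

end lineConv

/-! ### The factors of `R^B` -/

section factor

variable {X : Fin N → Fin r → ℝ} {B : Finset (Fin N)}

/-- The vectors of the block of `b` other than `b`, reflected to the positive side. -/
def reflectedBlock (X : Fin N → Fin r → ℝ) (B : Finset (Fin N)) (b : Fin N) :
    List (Fin r → ℝ) :=
  (((posPart X (Finset.univ \ extActive X B) B b).erase b).toList.map X) ++
    ((negPart X (Finset.univ \ extActive X B) B b).toList.map fun i => -X i)

lemma mem_posPart (hB : IsBasis X B) {b : Fin N} (hb : b ∈ B) {i : Fin N}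
    (hi : i ∈ posPart X (Finset.univ \ extActive X B) B b) :
    X i ∈ flagLE X B b ∧ 0 < coord X B b (X i) := by
  rw [posPart, Finset.mem_filter] at hi
  exact ⟨hi.2.1, (isPositive_iff hB hb hi.2.1).1 hi.2.2.2⟩

lemma mem_negPart (hB : IsBasis X B) {b : Fin N} (hb : b ∈ B) {i : Fin N}
    (hi : i ∈ negPart X (Finset.univ \ extActive X B) B b) :
    X i ∈ flagLE X B b ∧ coord X B b (X i) < 0 := by
  rw [negPart, Finset.mem_filter] at hi
  exact ⟨hi.2.1, lt_of_le_of_ne (not_lt.1 fun h => hi.2.2.2 ((isPositive_iff hB hb hi.2.1).2 h))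
    fun h => hi.2.2.1 ((mem_flagLT_iff_of_mem hB hb hi.2.1).2 h)⟩

lemma self_mem_posPart (hB : IsBasis X B) {b : Fin N} (hb : b ∈ B) :
    b ∈ posPart X (Finset.univ \ extActive X B) B b := by
  have h := self_mem_block hB hb
  rw [block, Finset.mem_filter] at h
  rw [posPart, Finset.mem_filter]
  exact ⟨h.1, h.2.1, h.2.2, (1 : ℝ), one_pos, by simp⟩

lemma mem_reflectedBlock (hB : IsBasis X B) {b : Fin N} (hb : b ∈ B) (y : Fin r → ℝ)
    (hy : y ∈ reflectedBlock X B b) : y ∈ flagLE X B b ∧ 0 < coord X B b y := by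
  rw [reflectedBlock, List.mem_append] at hy
  rcases hy with hy | hy
  · obtain ⟨i, hi, rfl⟩ := List.mem_map.1 hy
    exact mem_posPart hB hb (Finset.mem_of_mem_erase (Finset.mem_toList.1 hi))
  · obtain ⟨i, hi, rfl⟩ := List.mem_map.1 hy
    have := mem_negPart hB hb (Finset.mem_toList.1 hi)
    exact ⟨Submodule.neg_mem _ this.1, by rw [map_neg]; linarith [this.2]⟩

lemma self_mem_flagLE (b : Fin N) (hb : b ∈ B) : X b ∈ flagLE X B b :=
  Submodule.subset_span ⟨b, ⟨hb, le_rfl⟩, rfl⟩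

lemma flagLT_le_flagLE (X : Fin N → Fin r → ℝ) (B : Finset (Fin N)) (b : Fin N) :
    flagLT X B b ≤ flagLE X B b :=
  Submodule.span_mono (Set.image_mono fun _ hc => ⟨hc.1, hc.2.le⟩)

lemma mem_flagLE_iff_sub (hB : IsBasis X B) {b : Fin N} (hb : b ∈ B) (u : Fin r → ℝ) :
    u ∈ flagLE X B b ↔ u - coord X B b u • X b ∈ flagLT X B b := by
  refine ⟨sub_coord_smul_mem_flagLT hB hb, fun h => ?_⟩
  have := Submodule.add_mem _ (flagLT_le_flagLE X B b h) (Submodule.smul_mem _ (coord X B b u) (self_mem_flagLE b hb))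
  rwa [sub_add_cancel] at this

lemma coord_eq_zero_of_mem_flagLT (hB : IsBasis X B) {b : Fin N} (hb : b ∈ B) (s : Fin r → ℝ)
    (hs : s ∈ flagLT X B b) : coord X B b s = 0 :=
  (mem_flagLT_iff hB).1 hs b hb le_rfl

lemma flagLT_subset_halfSpace (hB : IsBasis X B) {b : Fin N} (hb : b ∈ B)
    (t : Module.Dual ℝ (Fin r → ℝ)) (ht : t = coord X B b ∨ t = -coord X B b) :
    (flagLT X B b : Set (Fin r → ℝ)) ⊆ halfSpace (flagLE X B b) t := by
  intro s hs
  refine ⟨flagLT_le_flagLE X B b hs, ?_⟩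
  have := coord_eq_zero_of_mem_flagLT hB hb s hs
  rcases ht with rfl | rfl <;> simp [this]

lemma neg_reflectedBlock (b : Fin N) :
    (reflectedBlock X B b).map Neg.neg =
      (((posPart X (Finset.univ \ extActive X B) B b).erase b).toList.map fun i => -X i) ++
        ((negPart X (Finset.univ \ extActive X B) B b).toList.map X) := by
  simp [reflectedBlock, Function.comp_def]

/-- All rays of the first term point to the positive side of `Sᵢ₋₁` in `Sᵢ`, all rays of the second
to the negative side, and `s ∈ Sᵢ₋₁` belongs to both closed half-spaces. -/
lemma factorR_eq_rays (hB : IsBasis X B) {b : Fin N} (hb : b ∈ B) {g : (Fin r → ℝ) → ℝ}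
    (hg : NiceOn (flagLE X B b) g) {s : Fin r → ℝ} (hs : s ∈ flagLT X B b) :
    (factorR X (Finset.univ \ extActive X B) B b fun v => g (s + v)) =
      (-1 : ℝ) ^ (negPart X (Finset.univ \ extActive X B) B b).card *
        (rays (X b :: reflectedBlock X B b) fun v => g (s + v)) -
      (-1 : ℝ) ^ (posPart X (Finset.univ \ extActive X B) B b).card *
        (rays (-X b :: (reflectedBlock X B b).map Neg.neg) fun v => g (s + v)) := by
  have hnd : (b :: ((posPart X (Finset.univ \ extActive X B) B b).erase b).toList).Nodup := by
    simp [Finset.nodup_toList]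
  have hmem : ∀ i, i ∈ b :: ((posPart X (Finset.univ \ extActive X B) B b).erase b).toList ↔
      i ∈ posPart X (Finset.univ \ extActive X B) B b := by
    intro i
    have := self_mem_posPart hB hb
    by_cases hi : i = b
    · subst hi; simp [this]
    · simp [hi]
  have hmem' : ∀ i, i ∈ (negPart X (Finset.univ \ extActive X B) B b).toList ↔
      i ∈ negPart X (Finset.univ \ extActive X B) B b := fun i => Finset.mem_toList
  have hsub (t) : halfSpace (flagLE X B b) t ⊆ flagLE X B b := fun _ h => h.1
  have h1 := convolve_spline_eq_rays (S := flagLE X B b) (t := coord X B b) (v := X)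
    (w := fun i => -X i) hnd hmem (Finset.nodup_toList _) hmem'
    (fun i hi => mem_posPart hB hb hi)
    (fun i hi => ⟨Submodule.neg_mem _ (mem_negPart hB hb hi).1, by
      rw [map_neg]; linarith [(mem_negPart hB hb hi).2]⟩)
    (hg.mono (measurableSet_halfSpace _ _) (hsub _))
    (flagLT_subset_halfSpace hB hb _ (.inl rfl) hs)
  have h2 := convolve_spline_eq_rays (S := flagLE X B b) (t := -coord X B b) (v := fun i => -X i)
    (w := X) hnd hmem (Finset.nodup_toList _) hmem'
    (fun i hi => ⟨Submodule.neg_mem _ (mem_posPart hB hb hi).1, by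
      simpa using (mem_posPart hB hb hi).2⟩)
    (fun i hi => ⟨(mem_negPart hB hb hi).1, by
      simpa using (mem_negPart hB hb hi).2⟩)
    (hg.mono (measurableSet_halfSpace _ _) (hsub _))
    (flagLT_subset_halfSpace hB hb _ (.inr rfl) hs)
  rw [List.map_cons, List.cons_append] at h1 h2
  rw [neg_reflectedBlock, reflectedBlock, ← h1, ← h2]
  rfl

lemma neg_mem_reflectedBlock (hB : IsBasis X B) {b : Fin N} (hb : b ∈ B) (y : Fin r → ℝ)
    (hy : y ∈ (reflectedBlock X B b).map Neg.neg) :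
    y ∈ flagLE X B b ∧ 0 < (-coord X B b) y := by
  obtain ⟨z, hz, rfl⟩ := List.mem_map.1 hy
  have := mem_reflectedBlock hB hb z hz
  exact ⟨Submodule.neg_mem _ this.1, by simpa using this.2⟩

lemma niceOn_rays_cons {S S' : Submodule ℝ (Fin r → ℝ)} {t : Module.Dual ℝ (Fin r → ℝ)}
    (hsub : (S : Set (Fin r → ℝ)) ⊆ halfSpace S' t) {L : List (Fin r → ℝ)}
    (hL : ∀ y ∈ L, y ∈ S' ∧ 0 < t y) {g : (Fin r → ℝ) → ℝ} (hg : NiceOn S' g) :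
    NiceOn S fun s => rays L fun v => g (s + v) :=
  ((hg.mono (measurableSet_halfSpace S' t) fun _ h => h.1).rays hL).mono
    (measurableSet_submodule S) hsub

lemma mem_cons_reflectedBlock (hB : IsBasis X B) {b : Fin N} (hb : b ∈ B) (y : Fin r → ℝ)
    (hy : y ∈ X b :: reflectedBlock X B b) : y ∈ flagLE X B b ∧ 0 < coord X B b y := by
  rcases List.mem_cons.1 hy with rfl | hy
  · exact ⟨self_mem_flagLE b hb, by simp [coord_apply hB hb hb]⟩
  · exact mem_reflectedBlock hB hb y hy

lemma neg_mem_cons_reflectedBlock (hB : IsBasis X B) {b : Fin N} (hb : b ∈ B) (y : Fin r → ℝ)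
    (hy : y ∈ -X b :: (reflectedBlock X B b).map Neg.neg) :
    y ∈ flagLE X B b ∧ 0 < (-coord X B b) y := by
  rcases List.mem_cons.1 hy with rfl | hy
  · exact ⟨Submodule.neg_mem _ (self_mem_flagLE b hb), by simp [coord_apply hB hb hb]⟩
  · exact neg_mem_reflectedBlock hB hb y hy

lemma NiceOn.factorR (hB : IsBasis X B) {b : Fin N} (hb : b ∈ B) {g : (Fin r → ℝ) → ℝ}
    (hg : NiceOn (flagLE X B b) g) :
    NiceOn (flagLT X B b) fun s =>
      ZonotopalSpaces.factorR X (Finset.univ \ extActive X B) B b fun v => g (s + v) := by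
  have h1 := niceOn_rays_cons (flagLT_subset_halfSpace hB hb _ (.inl rfl))
    (mem_cons_reflectedBlock hB hb) hg
  have h2 := niceOn_rays_cons (flagLT_subset_halfSpace hB hb _ (.inr rfl))
    (neg_mem_cons_reflectedBlock hB hb) hg
  have h3 := (BddMeas.const_mul h1
    ((-1 : ℝ) ^ (negPart X (Finset.univ \ extActive X B) B b).card)).sub
    (BddMeas.const_mul h2 ((-1 : ℝ) ^ (posPart X (Finset.univ \ extActive X B) B b).card))
  rw [NiceOn]
  convert h3 using 1
  ext s
  by_cases hs : s ∈ (flagLT X B b : Set (Fin r → ℝ))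
  · simp only [Set.indicator_of_mem hs]
    exact factorR_eq_rays hB hb hg hs
  · simp only [Set.indicator_of_notMem hs, mul_zero, sub_zero]

lemma antiderivs_reflectedBlock (hB : IsBasis X B) {b : Fin N} (hb : b ∈ B)
    (p : MvPolynomial (Fin r) ℝ) :
    antiderivs (coord X B b) (reflectedBlock X B b) p =
      (-1 : ℝ) ^ (negPart X (Finset.univ \ extActive X B) B b).card • blockPoly X B p b := by
  have hneg : ∀ y ∈ (negPart X (Finset.univ \ extActive X B) B b).toList.map X,
      coord X B b y ≠ 0 := by
    intro y hy
    obtain ⟨i, hi, rfl⟩ := List.mem_map.1 hy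
    exact (mem_negPart hB hb (Finset.mem_toList.1 hi)).2.ne
  have h : ((negPart X (Finset.univ \ extActive X B) B b).toList.map fun i => -X i) =
      ((negPart X (Finset.univ \ extActive X B) B b).toList.map X).map Neg.neg := by
    simp [Function.comp_def]
  rw [reflectedBlock, antiderivs_append, h, antiderivs_map_neg hneg, blockPoly, blockList,
    List.map_append, antiderivs_append]
  simp

/-- The list omits `b`, so reflection costs the sign `(-1)^(|P| + |N| - 1)`. The resulting minus
sign cancels the one in `T⁺ - T⁻`, and both halves carry the same polynomial. -/
lemma antiderivs_neg_reflectedBlock (hB : IsBasis X B) {b : Fin N} (hb : b ∈ B)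
    (p : MvPolynomial (Fin r) ℝ) :
    antiderivs (-coord X B b) ((reflectedBlock X B b).map Neg.neg) p =
      -((-1 : ℝ) ^ (posPart X (Finset.univ \ extActive X B) B b).card • blockPoly X B p b) := by
  have hne : ∀ y ∈ reflectedBlock X B b, coord X B b y ≠ 0 :=
    fun y hy => (mem_reflectedBlock hB hb y hy).2.ne'
  have hcard : (reflectedBlock X B b).length + 1 =
      (posPart X (Finset.univ \ extActive X B) B b).card +
        (negPart X (Finset.univ \ extActive X B) B b).card := by
    have := Finset.card_erase_add_one (self_mem_posPart hB hb)
    simp only [reflectedBlock, List.length_append, List.length_map, Finset.length_toList]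
    omega
  have hsign : (-1 : ℝ) ^ (reflectedBlock X B b).length *
      (-1 : ℝ) ^ (negPart X (Finset.univ \ extActive X B) B b).card =
      -(-1 : ℝ) ^ (posPart X (Finset.univ \ extActive X B) B b).card := by
    have h1 : (-1 : ℝ) ^ (reflectedBlock X B b).length =
        -((-1 : ℝ) ^ (posPart X (Finset.univ \ extActive X B) B b).card *
          (-1 : ℝ) ^ (negPart X (Finset.univ \ extActive X B) B b).card) := by
      rw [← pow_add, ← hcard, pow_succ]; ring
    rw [h1, neg_mul, mul_assoc, ← mul_pow]
    simp
  rw [antiderivs_neg_dual, antiderivs_map_neg hne, antiderivs_reflectedBlock hB hb, smul_smul,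
    hsign, neg_smul]
  intro y hy
  obtain ⟨z, hz, rfl⟩ := List.mem_map.1 hy
  simpa using hne z hz

/-- The factor `Rᵢ` maps polynomial densities on `Sᵢ₋₁` to polynomial densities on `Sᵢ`. -/
lemma integral_factorR (hB : IsBasis X B) {b : Fin N} (hb : b ∈ B) {μ : Measure (Fin r → ℝ)}
    (hμ : IsLebesgueOn (flagLT X B b) μ) {g : (Fin r → ℝ) → ℝ} (hg : NiceOn (flagLE X B b) g)
    {p : MvPolynomial (Fin r) ℝ} (hp : dirD (X b) p = 0) :
    ∫ s, eval s p *
      (factorR X (Finset.univ \ extActive X B) B b fun v => g (s + v)) ∂μ =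
      ∫ u, eval u (blockPoly X B p b) * g u ∂lineConv μ (X b) := by
  have := hμ.locallyFinite
  have hS := coord_eq_zero_of_mem_flagLT hB hb
  have ht : coord X B b (X b) = 1 := by simp [coord_apply hB hb hb]
  have hS' := mem_flagLE_iff_sub hB hb
  have hν := hμ.lineConv hS ht hS'
  have := hν.locallyFinite
  have hint : ∀ {G : (Fin r → ℝ) → ℝ}, NiceOn (flagLT X B b) G →
      Integrable (fun s => eval s p * G s) μ := by
    intro G hG
    refine ((BddMeas.continuous_mul hG (continuous_eval_poly p)).integrable μ).congr ?_
    filter_upwards [hμ.ae_mem] with s hs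
    rw [Set.indicator_of_mem (SetLike.mem_coe.2 hs)]
  have hi1 := hint (niceOn_rays_cons (flagLT_subset_halfSpace hB hb _ (.inl rfl))
    (mem_cons_reflectedBlock hB hb) hg)
  have hi2 := hint (niceOn_rays_cons (flagLT_subset_halfSpace hB hb _ (.inr rfl))
    (neg_mem_cons_reflectedBlock hB hb) hg)
  have hg1 : NiceOn (halfSpace (flagLE X B b) (coord X B b)) g :=
    hg.mono (measurableSet_halfSpace _ _) fun _ h => h.1
  have hg2 : NiceOn (halfSpace (flagLE X B b) (-coord X B b)) g :=
    hg.mono (measurableSet_halfSpace _ _) fun _ h => h.1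
  have e1 := integral_rays_cons hμ hS ht hS' (mem_reflectedBlock hB hb) hg1 hp
  have e2 := integral_rays_cons (b := -X b) (t := -coord X B b) hμ
    (fun s hs => by simp [hS s hs]) (by simpa using ht) (fun u => by simpa using hS' u)
    (neg_mem_reflectedBlock hB hb) hg2 (by rw [dirD_neg, hp, neg_zero])
  rw [lineConv_neg, antiderivs_neg_reflectedBlock hB hb] at e2
  rw [antiderivs_reflectedBlock hB hb] at e1
  have hsq : ∀ n : ℕ, (-1 : ℝ) ^ n * (-1 : ℝ) ^ n = 1 := fun n => by rw [← mul_pow]; simp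
  have hcalc : ∫ s, eval s p *
      (factorR X (Finset.univ \ extActive X B) B b fun v => g (s + v)) ∂μ =
      (-1 : ℝ) ^ (negPart X (Finset.univ \ extActive X B) B b).card *
        (∫ s, eval s p * (rays (X b :: reflectedBlock X B b) fun v => g (s + v)) ∂μ) -
      (-1 : ℝ) ^ (posPart X (Finset.univ \ extActive X B) B b).card *
        (∫ s, eval s p *
          (rays (-X b :: (reflectedBlock X B b).map Neg.neg) fun v => g (s + v)) ∂μ) := by
    rw [← integral_const_mul, ← integral_const_mul,
      ← integral_sub (hi1.const_mul _) (hi2.const_mul _)]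
    refine integral_congr_ae ?_
    filter_upwards [hμ.ae_mem] with s hs
    rw [factorR_eq_rays hB hb hg hs]
    ring
  rw [hcalc, e1, e2]
  simp only [smul_eval, map_neg, neg_mul, mul_assoc, integral_neg, integral_const_mul,
    mul_neg, sub_neg_eq_add]
  rw [← mul_assoc, ← mul_assoc, hsq, hsq, one_mul, one_mul]
  have hA := measurableSet_halfSpace (flagLE X B b) (coord X B b)
  have hGg : Integrable (fun u => eval u (blockPoly X B p b) * g u) (lineConv μ (X b)) := by
    refine ((BddMeas.continuous_mul hg (continuous_eval_poly (blockPoly X B p b))).integrable _).congr ?_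
    filter_upwards [hν.ae_mem] with s hs
    rw [Set.indicator_of_mem (SetLike.mem_coe.2 hs)]
  -- The closed half-space for `-coord X B b` agrees almost everywhere with the complement of the
  -- one for `coord X B b`.
  rw [← integral_add_compl hA hGg]
  congr 1
  refine setIntegral_congr_set ?_
  filter_upwards [hν.ae_mem, hμ.ae_ne_zero hS ht] with u hu hu0
  refine propext ?_
  change (u ∈ flagLE X B b ∧ 0 ≤ (-coord X B b) u) ↔ ¬ (u ∈ flagLE X B b ∧ 0 ≤ coord X B b u)
  simp only [hu, true_and, LinearMap.neg_apply, Left.nonneg_neg_iff, not_le]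
  exact ⟨fun h => lt_of_le_of_ne h hu0, le_of_lt⟩

end factor

/-! ### The distributions `R^B` are polynomials -/

section distR

variable {X : Fin N → Fin r → ℝ} {B : Finset (Fin N)}

/-- The span of the elements of `B` that occur in the list `l`. -/
def listSpan (X : Fin N → Fin r → ℝ) (B : Finset (Fin N)) (l : List (Fin N)) :
    Submodule ℝ (Fin r → ℝ) :=
  Submodule.span ℝ (X '' {c | c ∈ B ∧ c ∈ l})

lemma sort_split_lt {pre suf : List (Fin N)} {b : Fin N}
    (hl : B.sort (· ≤ ·) = pre ++ b :: suf) :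
    (∀ c ∈ pre, c < b) ∧ ∀ c ∈ suf, b < c := by
  have h : (pre ++ b :: suf).Pairwise (· < ·) := hl ▸ Finset.sortedLT_sort B |>.pairwise
  rw [List.pairwise_append, List.pairwise_cons] at h
  exact ⟨fun c hc => h.2.2 c hc b (by simp), h.2.1.1⟩

lemma mem_of_sort_eq {pre suf : List (Fin N)} (hl : B.sort (· ≤ ·) = pre ++ suf) (c : Fin N) :
    c ∈ B ↔ c ∈ pre ∨ c ∈ suf := by
  rw [← Finset.mem_sort (· ≤ ·), hl, List.mem_append]

lemma listSpan_eq_flagLT {pre suf : List (Fin N)} {b : Fin N}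
    (hl : B.sort (· ≤ ·) = pre ++ b :: suf) : listSpan X B pre = flagLT X B b := by
  obtain ⟨h1, h2⟩ := sort_split_lt hl
  rw [listSpan, flagLT]
  congr 2
  ext c
  refine and_congr_right fun hc => ⟨h1 c, fun hlt => ?_⟩
  rw [mem_of_sort_eq hl, List.mem_cons] at hc
  rcases hc with hc | rfl | hc
  · exact hc
  · exact absurd hlt (lt_irrefl _)
  · exact absurd hlt (h2 c hc).not_gt

lemma listSpan_append_eq_flagLE {pre suf : List (Fin N)} {b : Fin N}
    (hl : B.sort (· ≤ ·) = pre ++ b :: suf) : listSpan X B (pre ++ [b]) = flagLE X B b := by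
  obtain ⟨h1, h2⟩ := sort_split_lt hl
  rw [listSpan, flagLE]
  congr 2
  ext c
  refine and_congr_right fun hc => ⟨fun h => ?_, fun hle => ?_⟩
  · rw [List.mem_append, List.mem_singleton] at h
    rcases h with h | rfl
    · exact (h1 c h).le
    · exact le_rfl
  · rw [mem_of_sort_eq hl, List.mem_cons] at hc
    rcases hc with hc | rfl | hc
    · simp [hc]
    · simp
    · exact absurd hle (h2 c hc).not_ge

/-- The convolution of the factors of `R^B` that belong to a list. -/
def convFactors (X : Fin N → Fin r → ℝ) (B : Finset (Fin N)) (l : List (Fin N)) : Functional r :=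
  (l.map (factorR X (Finset.univ \ extActive X B) B)).foldr convolve (delta r)

lemma convFactors_cons (b : Fin N) (l : List (Fin N)) (φ : (Fin r → ℝ) → ℝ) (u : Fin r → ℝ) :
    (convFactors X B (b :: l) fun v => φ (u + v)) =
      factorR X (Finset.univ \ extActive X B) B b fun ξ =>
        convFactors X B l fun v => φ (u + ξ + v) := by
  simp only [convFactors, List.map_cons, List.foldr_cons, convolve, add_assoc]

lemma niceOn_convFactors (hB : IsBasis X B) {pre suf : List (Fin N)}
    (hl : B.sort (· ≤ ·) = pre ++ suf) {φ : (Fin r → ℝ) → ℝ} (hφ : BddMeas φ) :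
    NiceOn (listSpan X B pre) fun u => convFactors X B suf fun v => φ (u + v) := by
  induction suf generalizing pre with
  | nil => simpa [convFactors, delta, NiceOn] using hφ.indicator (measurableSet_submodule _)
  | cons b suf ih =>
    have hb : b ∈ B := (mem_of_sort_eq hl b).2 (by simp)
    have h := ih (pre := pre ++ [b]) (by simp [hl])
    rw [listSpan_append_eq_flagLE hl] at h
    rw [listSpan_eq_flagLT hl]
    simp only [convFactors_cons]
    exact h.factorR hB hb

/-- The factors are moved one by one from the functional into the density, which lives on the span
of `pre`. -/
lemma integral_convFactors (hB : IsBasis X B) {pre suf : List (Fin N)}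
    (hl : B.sort (· ≤ ·) = pre ++ suf) {φ : (Fin r → ℝ) → ℝ} (hφ : BddMeas φ)
    {μ : Measure (Fin r → ℝ)} (hμ : IsLebesgueOn (listSpan X B pre) μ)
    {p : MvPolynomial (Fin r) ℝ} (hp : ∀ c ∈ suf, dirD (X c) p = 0) :
    ∫ s, eval s p * (convFactors X B suf fun v => φ (s + v)) ∂μ =
      ∫ u, eval u (suf.foldl (blockPoly X B) p) * φ u
        ∂suf.foldl (fun ν b => lineConv ν (X b)) μ := by
  induction suf generalizing pre μ p with
  | nil => simp [convFactors, delta]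
  | cons b suf ih =>
    have hmem : ∀ c ∈ b :: suf, c ∈ B := fun c hc => (mem_of_sort_eq hl c).2 (.inr hc)
    have hb : b ∈ B := hmem b (by simp)
    have hl' : B.sort (· ≤ ·) = (pre ++ [b]) ++ suf := by simp [hl]
    have h := niceOn_convFactors hB hl' hφ
    rw [listSpan_append_eq_flagLE hl] at h
    rw [listSpan_eq_flagLT hl] at hμ
    simp only [convFactors_cons]
    rw [integral_factorR hB hb hμ h (hp b (by simp)), List.foldl_cons, List.foldl_cons]
    refine ih hl' ?_ fun c hc => ?_
    · rw [listSpan_append_eq_flagLE hl]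
      exact hμ.lineConv (coord_eq_zero_of_mem_flagLT hB hb) (by simp [coord_apply hB hb hb])
        (mem_flagLE_iff_sub hB hb)
    -- Later basis vectors have zero `b`-coordinate, so the new density is still constant along
    -- them.
    · have h1 := dirD_foldl_blockPoly (l := [b]) hB (by simpa using hb) (y := X c) (by
        have := ((sort_split_lt hl).2 c hc).ne
        simp [coord_apply hB hb (hmem c (by simp [hc])), this]) p
      rw [hp c (by simp [hc]), foldl_blockPoly_zero hB (by simpa using hb)] at h1
      exact h1

lemma foldl_lineConv_ofFn {n : ℕ} (v : Fin n → Fin r → ℝ) :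
    (List.ofFn v).foldl lineConv (Measure.dirac 0) =
      (volume : Measure (Fin n → ℝ)).map fun c => ∑ i, c i • v i := by
  induction n with
  | zero =>
    have h : (fun c : Fin 0 → ℝ => ∑ i, c i • v i) = fun _ => (0 : Fin r → ℝ) := by ext; simp
    rw [h, Measure.map_const]
    simp [volume_pi]
  | succ n ih =>
    have hm : Measurable fun c : Fin n → ℝ => ∑ i, c i • v i.castSucc := by fun_prop
    have hmp : MeasurePreserving (fun p : (Fin n → ℝ) × ℝ =>
        (MeasurableEquiv.piFinSuccAbove (fun _ : Fin (n + 1) => ℝ) (Fin.last n)).symm p.swap)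
        (volume.prod volume) volume :=
      (volume_preserving_piFinSuccAbove (fun _ : Fin (n + 1) => ℝ) (Fin.last n)).symm.comp
        Measure.measurePreserving_swap
    rw [List.ofFn_succ', List.concat_eq_append, List.foldl_append, ih, List.foldl_cons,
      List.foldl_nil, lineConv]
    have h1 := Measure.map_prod_map (volume : Measure (Fin n → ℝ)) (volume : Measure ℝ) hm
      measurable_id
    rw [Measure.map_id] at h1
    rw [h1, Measure.map_map (measurable_lineConv _) (hm.prodMap measurable_id),
      ← hmp.map_eq, Measure.map_map (by fun_prop) hmp.measurable]
    congr 1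
    ext p i
    simp [Fin.sum_univ_castSucc]

lemma card_eq_of_isBasis (hB : IsBasis X B) : B.card = r := by
  have h := Module.finrank_eq_card_basis (Module.Basis.mk hB.1 (by
      have h2 := hB.2
      rw [← h2, Set.image_eq_range]; rfl))
  simpa using h.symm

lemma basisDet_ne_zero (hB : IsBasis X B) : basisDet X B ≠ 0 := by
  rw [basisDet, dif_pos (card_eq_of_isBasis hB)]
  have h : LinearIndependent ℝ fun j : Fin r =>
      X (B.orderEmbOfFin (card_eq_of_isBasis hB) j) :=
    hB.1.comp (fun j => ⟨_, B.orderEmbOfFin_mem (card_eq_of_isBasis hB) j⟩)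
      fun i j hij => (B.orderEmbOfFin (card_eq_of_isBasis hB)).injective (Subtype.ext_iff.1 hij)
  have h2 : IsUnit (Matrix.of fun j i => X (B.orderEmbOfFin (card_eq_of_isBasis hB) j) i) :=
    Matrix.linearIndependent_rows_iff_isUnit.1 h
  rw [Matrix.isUnit_iff_isUnit_det] at h2
  rw [← Matrix.det_transpose]
  exact h2.ne_zero

/-- Adding one line at a time pushes Lebesgue measure forward along the matrix with columns `B`;
this is the origin of the factor `|det B|`. -/
lemma foldl_lineConv_sort (hB : IsBasis X B) :
    (B.sort (· ≤ ·)).foldl (fun ν b => lineConv ν (X b)) (Measure.dirac 0) =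
      ENNReal.ofReal |(basisDet X B)⁻¹| • volume := by
  have hdet := basisDet_ne_zero hB
  have hr := card_eq_of_isBasis hB
  rw [basisDet, dif_pos hr] at hdet ⊢
  have h1 : (B.sort (· ≤ ·)).foldl (fun ν b => lineConv ν (X b)) (Measure.dirac 0) =
      (List.ofFn fun j => X (B.orderEmbOfFin hr j)).foldl lineConv (Measure.dirac 0) := by
    rw [← Finset.listMap_orderEmbOfFin_finRange B hr, List.foldl_map, List.ofFn_eq_map,
      List.foldl_map]
  rw [h1, foldl_lineConv_ofFn, ← Real.map_matrix_volume_pi_eq_smul_volume_pi hdet]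
  congr 1
  ext c i
  simp [Matrix.mulVec, dotProduct, mul_comm]

/-- The distribution `R^B` is the polynomial `|det B|⁻¹ F_B`. -/
lemma isGivenBy_distR (hB : IsBasis X B) :
    IsGivenBy (distR X (Finset.univ \ extActive X B) B) (|basisDet X B|⁻¹ • polyF X B) := by
  intro φ
  have hφ : BddMeas (φ : (Fin r → ℝ) → ℝ) := by
    obtain ⟨M, hM⟩ := φ.hasCompactSupport.exists_bound_of_continuous φ.continuous
    obtain ⟨R, hR⟩ := φ.hasCompactSupport.isBounded.exists_norm_le
    refine ⟨φ.continuous.measurable, M, R, fun u => ⟨hM u, fun hu => ?_⟩⟩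
    by_contra h
    exact absurd (hR u (subset_tsupport _ h)) (not_le.2 hu)
  have h0 : listSpan X B [] = ⊥ := by simp [listSpan]
  -- The start is `S₀ = 0` with the point mass at the origin and density `1`, where the left side is
  -- the functional itself.
  have h := integral_convFactors hB (pre := []) (suf := B.sort (· ≤ ·)) rfl hφ
    (μ := Measure.dirac 0) (by rw [h0]; exact isLebesgueOn_dirac) (p := 1)
    (fun c _ => (dirD (X c)).map_one_eq_zero)
  rw [integral_dirac, foldl_lineConv_sort hB, integral_smul_measure] at h
  simp only [map_one, one_mul, zero_add] at h
  change convFactors X B (B.sort (· ≤ ·)) (fun v => φ v) = _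
  rw [h, ENNReal.toReal_ofReal (abs_nonneg _), abs_inv, smul_eq_mul, ← integral_const_mul]
  simp only [smul_eval, mul_assoc]
  rfl

end distR

end ZonotopalSpaces

end

/-! ### Assembly: dual families and dual bases -/

theorem theorem6p4 {r N : ℕ} (X : Fin N → Fin r → ℝ)
    (hX : Submodule.span ℝ (Set.range X) = ⊤)
    (𝔹' : Set (Finset (Fin N)))
    (h𝔹' : 𝔹' ⊆ {B | ZonotopalSpaces.IsBasis X B})
    (hF : ZonotopalSpaces.ForwardExchange X 𝔹') :
    -- the two spaces are dual via the pairing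
    Function.Bijective (ZonotopalSpaces.dualityMap X 𝔹') ∧
    -- the distributions `R^B_{X ∖ E(B)}` are polynomials `R B`
    ∃ R : 𝔹' → MvPolynomial (Fin r) ℝ,
      (∀ B : 𝔹', ZonotopalSpaces.IsGivenBy
        (ZonotopalSpaces.distR X (Finset.univ \ ZonotopalSpaces.extActive X B) B) (R B)) ∧
      -- the polynomials `|det B| R B` form a basis of the `D`-space
      LinearIndependent ℝ (fun B : 𝔹' => |ZonotopalSpaces.basisDet X B| • R B) ∧
      Submodule.span ℝ (Set.range fun B : 𝔹' => |ZonotopalSpaces.basisDet X B| • R B) =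
        ZonotopalSpaces.spaceD X 𝔹' ∧
      -- the polynomials `Q_B` form a basis of the `P`-space
      LinearIndependent ℝ (fun B : 𝔹' => ZonotopalSpaces.polyQ X B) ∧
      Submodule.span ℝ (Set.range fun B : 𝔹' => ZonotopalSpaces.polyQ X B) =
        ZonotopalSpaces.spaceP X 𝔹' ∧
      -- and the two bases are dual to each other
      ∀ B D : 𝔹', ZonotopalSpaces.pairing r (ZonotopalSpaces.polyQ X B)
        (|ZonotopalSpaces.basisDet X D| • R D) = if B = D then 1 else 0 := by
  have hbasis : ∀ B ∈ 𝔹', ZonotopalSpaces.IsBasis X B := fun B hB => h𝔹' hB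
  have hdual : ∀ B D : 𝔹', ZonotopalSpaces.pairing r (ZonotopalSpaces.polyQ X B)
      (ZonotopalSpaces.polyF X D) = if B = D then 1 else 0 := fun B D => by
    rw [ZonotopalSpaces.pairing_polyQ_polyF (hbasis B B.2) (hbasis D D.2)]
    simp [Subtype.ext_iff]
  have hmem : ∀ D : 𝔹', ZonotopalSpaces.polyF X D ∈ ZonotopalSpaces.spaceD X 𝔹' :=
    fun D => ZonotopalSpaces.polyF_mem_spaceD hF (hbasis D D.2) D.2
  have hQmem : ∀ B : 𝔹', ZonotopalSpaces.polyQ X B ∈ ZonotopalSpaces.spaceP X 𝔹' :=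
    fun B => Submodule.subset_span ⟨B, B.2, rfl⟩
  -- With `R B = |det B|⁻¹ • polyF X B` the determinants cancel, and only `polyF` remains to be
  -- considered.
  have hscale : ∀ B : 𝔹', |ZonotopalSpaces.basisDet X B| •
      |ZonotopalSpaces.basisDet X B|⁻¹ • ZonotopalSpaces.polyF X B =
        ZonotopalSpaces.polyF X B := fun B => by
    rw [smul_smul, mul_inv_cancel₀ (abs_ne_zero.2 (ZonotopalSpaces.basisDet_ne_zero
      (hbasis B B.2))), one_smul]
  have hP : Submodule.span ℝ (Set.range fun B : 𝔹' => ZonotopalSpaces.polyQ X B) =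
      ZonotopalSpaces.spaceP X 𝔹' := by
    rw [ZonotopalSpaces.spaceP, Set.image_eq_range]
  have : Fintype 𝔹' := Fintype.ofFinite _
  have hindF : LinearIndependent ℝ fun B : 𝔹' => ZonotopalSpaces.polyF X B := by
    rw [Fintype.linearIndependent_iff]
    intro c hc B
    have h := congrArg (ZonotopalSpaces.pairing r (ZonotopalSpaces.polyQ X B)) hc
    simpa [hdual] using h
  have hindQ : LinearIndependent ℝ fun B : 𝔹' => ZonotopalSpaces.polyQ X B := by
    rw [Fintype.linearIndependent_iff]
    intro c hc B
    have h := congrArg (fun q => ZonotopalSpaces.pairing r q (ZonotopalSpaces.polyF X B)) hc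
    simpa [hdual] using h
  refine ⟨⟨?_, ?_⟩, fun B => |ZonotopalSpaces.basisDet X B|⁻¹ • ZonotopalSpaces.polyF X B,
    fun B => ZonotopalSpaces.isGivenBy_distR (hbasis B B.2), ?_, ?_, hindQ, hP, ?_⟩
  · rw [injective_iff_map_eq_zero]
    intro f hf
    refine Subtype.ext (ZonotopalSpaces.eq_zero_of_mem_spaceD hbasis hF f.2 fun B hB => ?_)
    exact LinearMap.congr_fun hf ⟨_, hQmem ⟨B, hB⟩⟩
  · intro ψ
    -- Surjectivity: the preimage of `ψ` is the combination of the dual family with the values of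
    -- `ψ` at the `Q_B` as coefficients.
    obtain ⟨f, hf⟩ : ∃ f : ZonotopalSpaces.spaceD X 𝔹', ∀ B : 𝔹',
        ZonotopalSpaces.pairing r (ZonotopalSpaces.polyQ X B) f = ψ ⟨_, hQmem B⟩ :=
      ⟨∑ B : 𝔹', ψ ⟨_, hQmem B⟩ • (⟨_, hmem B⟩ : ZonotopalSpaces.spaceD X 𝔹'),
        fun B => by simp [hdual]⟩
    refine ⟨f, LinearMap.ext fun q => ?_⟩
    obtain ⟨q, hq⟩ := q
    have hq' := hq
    rw [← hP, Submodule.mem_span_range_iff_exists_fun] at hq'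
    obtain ⟨c, rfl⟩ := hq'
    have h1 : (⟨_, hq⟩ : ZonotopalSpaces.spaceP X 𝔹') =
        ∑ B : 𝔹', c B • (⟨_, hQmem B⟩ : ZonotopalSpaces.spaceP X 𝔹') := Subtype.ext (by simp)
    rw [h1, map_sum, map_sum]
    refine Finset.sum_congr rfl fun B _ => ?_
    rw [map_smul, map_smul, ← hf B]
    rfl
  · simpa only [hscale] using hindF
  · simp only [hscale]
    refine le_antisymm (Submodule.span_le.2 ?_) fun f hf => ?_
    · rintro _ ⟨B, rfl⟩
      exact hmem B
    -- Subtracting the dual expansion makes `f` orthogonal to all `Q_B`, so injectivity of the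
    -- pairing gives spanning.
    · have h : f - ∑ B : 𝔹', ZonotopalSpaces.pairing r (ZonotopalSpaces.polyQ X B) f •
          ZonotopalSpaces.polyF X B = 0 := by
        refine ZonotopalSpaces.eq_zero_of_mem_spaceD hbasis hF (Submodule.sub_mem _ hf
          (Submodule.sum_mem _ fun B _ => Submodule.smul_mem _ _ (hmem B))) fun B hB => ?_
        have := hdual ⟨B, hB⟩
        simp only at this
        simp [this]
      rw [sub_eq_zero.1 h]
      exact Submodule.sum_mem _ fun B _ => Submodule.smul_mem _ _
        (Submodule.subset_span ⟨B, rfl⟩)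
  · intro B D
    rw [hscale, hdual]
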